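/- Let $\Gamma$ be a finite, connected simple graph whose edges $e$ are labelled by integers $M_e\ge 2$, with vertex set $V$ and edge set $E$, and let $$\mathrm{Art}_\Gamma=\langle a\in V \mid \underbrace{abab\cdots}_{M_{\{a,b\}}}=\underbrace{baba\cdots}_{M_{\{a,b\}}}\ \text{ for all } \{a,b\}\in E\rangle$$ be its Artin group. A *partial orientation* $\iota$ of $\Gamma$ is a choice of an endpoint $\iota(e)$, the origin of $e$, for some of the edges $e$. Paths and cycles in $\Gamma$ are walks, respectively closed walks of positive length, without backtracking (for a cycle, also not at its base point); they need not be simple. A path of length $\ge 2$ is *misdirected* if the partial orientation that $\iota$ induces on its edges extends to an orientation of all its edges for which every maximal directed subpath has length $1$ (that is, consecutive edges point in opposite directions along the path). A cycle is *almost misdirected* if it can be written as $(a_1,\dots,a_n,a_1)$ with $(a_1,\dots,a_n)$ a misdirected path. The partial orientation $\iota$ is *admissible* if $\iota(e)$ is defined exactly for the edges with $M_e\ge 3$, and no cycle of $\Gamma$ is almost misdirected. Suppose that $\Gamma$ admits an admissible partial orientation. 1. If $\Gamma$ is bipartite and all labels are even, then $\mathrm{Art}_\Gamma$ is isomorphic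 to an HNN extension $A*_B$ (one stable letter conjugating one embedded copy of $B$ in $A$ to another), where $A$ and $B$ are free groups of finite rank with $\operatorname{rank} A=|E|$ and $\operatorname{rank} B=1-|V|+2|E|$. 2. Otherwise $\mathrm{Art}_\Gamma$ is isomorphic to an amalgamated free product $A*_C B$ over injective homomorphisms $C\to A$ and $C\to B$, where $A$, $B$, $C$ are free groups of finite rank with $\operatorname{rank} A=|E|$, $\operatorname{rank} B=1-|V|+2|E|$, the image of $C$ has index $2$ in $B$, and $\operatorname{rank} C=1-2|V|+4|E|$. -/

import Mathlib

/-- The alternating word `x y x y ...` with `n` letters, evaluated in a monoid. -/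
def alternatingProd {H : Type*} [Monoid H] (x y : H) : ℕ → H
  | 0 => 1
  | n + 1 => x * alternatingProd y x n

/-- The relators `(a,b)_M ((b,a)_M)⁻¹`, one for each ordered pair of adjacent vertices `a`, `b`,
where `M` is the label of the edge `{a, b}`. -/
def artinRelators {V : Type*} (Γ : SimpleGraph V) (M : Γ.edgeSet → ℕ) : Set (FreeGroup V) :=
  {r | ∃ (a b : V) (h : Γ.Adj a b),
    r = alternatingProd (FreeGroup.of a) (FreeGroup.of b) (M ⟨s(a, b), h⟩) *
      (alternatingProd (FreeGroup.of b) (FreeGroup.of a) (M ⟨s(a, b), h⟩))⁻¹}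

/-- The Artin group of the graph `Γ` with edge labels `M`. -/
abbrev ArtinGroup {V : Type*} (Γ : SimpleGraph V) (M : Γ.edgeSet → ℕ) : Type _ :=
  PresentedGroup (artinRelators Γ M)

/-- A partial orientation of a simple graph: a choice of an endpoint (the origin) for some of the
edges. The edge `e` is oriented if and only if `origin e` is not `none`. -/
structure PartialOrientation {V : Type*} (Γ : SimpleGraph V) where
  /-- The origin of an edge, if the edge is oriented. -/
  origin : Γ.edgeSet → Option V
  origin_mem : ∀ (e : Γ.edgeSet) (v : V), origin e = some v → v ∈ (e : Sym2 V)

namespace PartialOrientation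

variable {V : Type*} {Γ : SimpleGraph V}

/-- A walk without backtracking, that is, a combinatorial immersion of a subdivided interval.
Vertices and edges may be repeated. -/
def IsImmersedPath {u v : V} (w : Γ.Walk u v) : Prop :=
  ∀ i : ℕ, i + 2 ≤ w.length → w.getVert i ≠ w.getVert (i + 2)

/-- A closed walk of positive length without backtracking, also at its base point, that is, a
combinatorial immersion of a subdivided circle. Vertices and edges may be repeated. -/
def IsImmersedCycle {u : V} (w : Γ.Walk u u) : Prop :=
  0 < w.length ∧ IsImmersedPath w ∧ w.penultimate ≠ w.snd

/-- An orientation of the edges of a walk is a function `o`, where `o i` is `true` if the `i`-th edge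
of the walk points forward (its origin is the `i`-th vertex) and `false` if it points backward. It
extends `ι` if it agrees with it on all edges of the walk that `ι` orients. An edge that is traversed
several times and is not oriented by `ι` may be oriented differently at each passage. -/
def IsExtendedBy (ι : PartialOrientation Γ) {u v : V} (w : Γ.Walk u v) (o : ℕ → Bool) : Prop :=
  ∀ (i : ℕ) (hi : i < w.length) (a : V),
    ι.origin ⟨s(w.getVert i, w.getVert (i + 1)), w.adj_getVert_succ hi⟩ = some a →
      a = if o i then w.getVert i else w.getVert (i + 1)

/-- With respect to the orientation `o` of the edges of a walk, the subpath from the `i`-th to the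
`j`-th vertex is directed: all its edges point the same way along it. -/
def IsDirectedSegment (o : ℕ → Bool) (i j : ℕ) : Prop :=
  ∀ k l : ℕ, i ≤ k → k < j → i ≤ l → l < j → o k = o l

/-- A path of length at least `2` is misdirected if the partial orientation induced on it extends to
an orientation for which directed subpaths have length at most `1`. -/
def IsMisdirectedPath (ι : PartialOrientation Γ) {u v : V} (w : Γ.Walk u v) : Prop :=
  2 ≤ w.length ∧ IsImmersedPath w ∧
    ∃ o : ℕ → Bool, ι.IsExtendedBy w o ∧
      ∀ i j : ℕ, i ≤ j → j ≤ w.length → IsDirectedSegment o i j → j - i ≤ 1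

/-- The closed walk `(a₁, …, aₙ, a₁)` is a cycle and the path `(a₁, …, aₙ)` is misdirected. A cycle is
almost misdirected if one of the closed walks that run around it (for some choice of the base point
and of the direction) has this property. -/
def IsAlmostMisdirectedCycle (ι : PartialOrientation Γ) {u : V} (w : Γ.Walk u u) : Prop :=
  IsImmersedCycle w ∧ ι.IsMisdirectedPath w.dropLast

/-- A partial orientation of a labelled graph is admissible if precisely the edges with label at
least `3` are oriented, and no cycle is almost misdirected. -/
def IsAdmissible (ι : PartialOrientation Γ) (M : Γ.edgeSet → ℕ) : Prop :=
  (∀ e : Γ.edgeSet, (∃ v : V, ι.origin e = some v) ↔ 3 ≤ M e) ∧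
    ∀ (u : V) (w : Γ.Walk u u), ¬ ι.IsAlmostMisdirectedCycle w

end PartialOrientation

/-- The group `H` is free of finite rank, and its rank is the integer `r`. -/
def IsFreeOfRank (H : Type*) [Group H] (r : ℤ) : Prop :=
  ∃ n : ℕ, (n : ℤ) = r ∧ Nonempty (H ≃* FreeGroup (Fin n))

/-- The two factors of an amalgamated product, as a family. -/
def AmalgamFactor (A B : Type) : Bool → Type
  | false => A
  | true => B

instance AmalgamFactor.instGroup (A B : Type) [Group A] [Group B] :
    ∀ i : Bool, Group (AmalgamFactor A B i)
  | false => inferInstanceAs (Group A)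
  | true => inferInstanceAs (Group B)

/-- The maps from the amalgamated group to the two factors, as a family. -/
def amalgamMap {A B C : Type} [Group A] [Group B] [Group C] (α : C →* A) (β : C →* B) :
    ∀ i : Bool, C →* AmalgamFactor A B i
  | false => α
  | true => β

/-- The amalgamated product `A *_C B` with respect to `α : C → A` and `β : C → B`
(to be used for injective `α` and `β`). -/
abbrev AmalgamatedProduct {A B C : Type} [Group A] [Group B] [Group C]
    (α : C →* A) (β : C →* B) : Type :=
  Monoid.PushoutI (amalgamMap α β)

/-! Adjoin a generator x = ab for every edge e = {a, b}, where a is the origin if e is oriented. The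
Artin relation becomes the pair a = x b⁻¹, b = x^⌊M/2⌋ a^{±1} x^{-⌊(M-1)/2⌋}, with a inverted
exactly if M is even. So the group is given by 2|E| relations between letters in V with coefficients
in the free group A on the edges. The relations a = x b⁻¹ along a spanning tree identify all
letters, after inverting one colour class and multiplying by elements of A. One letter t and 2|E| -
|V| + 1 relations t = g t^{±1} h⁻¹ remain. Without signs this presents an HNN extension. Otherwise s
= t h, for a relation with a sign, has its square in A, and the group is an amalgam over an index
two subgroup.

It remains to see that the coefficients are free bases of the subgroups concerned. This follows from
`Developable`: each letter has two sides, points of a free F-set with an A-action, and coefficients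
carry side to side up to arbitrarily prescribed elements of F. For F free, words in the coefficients
then move a base point by distinct translations (`injective_of_rightTranslate`). The property
survives all changes of letters, so it suffices to prove it for the Artin relations
(`developable_artinSystem`).

Trivial coefficients force sides to agree up to translation: the `true` side of a with the `false`
side of b, and conversely too if M = 2. These are the edges of `sideGraph`, whose paths project to
misdirected paths. Admissibility therefore makes it a forest (`sideGraph_isAcyclic`), so the
translations are consistent, and keeps the other relevant sides apart. As A is free, each x can then
be built separately from cycles (`exists_perm_of_label`). -/

/-! ### Translations and signs -/

/-- The right translation by `g` on `S × F`. -/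
def rightTranslate {S F : Type*} [Mul F] (p : S × F) (g : F) : S × F := (p.1, p.2 * g)

theorem rightTranslate_mul {S F : Type*} [Semigroup F] (p : S × F) (g h : F) :
    rightTranslate p (g * h) = rightTranslate (rightTranslate p g) h := by
  simp [rightTranslate, mul_assoc]

@[simp] theorem rightTranslate_one {S F : Type*} [MulOneClass F] (p : S × F) :
    rightTranslate p 1 = p := by
  simp [rightTranslate]

theorem rightTranslate_left_injective {S F : Type*} [Group F] (p : S × F) :
    Function.Injective (rightTranslate p) := by
  intro g h e
  simpa [rightTranslate] using e

/-- The element `x⁻¹` if `s` is `true`, and `x` otherwise. -/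
def invIf {H : Type*} [Group H] (s : Bool) (x : H) : H := if s then x⁻¹ else x

@[simp] theorem invIf_true {H : Type*} [Group H] (x : H) : invIf true x = x⁻¹ := rfl

@[simp] theorem invIf_false {H : Type*} [Group H] (x : H) : invIf false x = x := rfl

theorem invIf_invIf {H : Type*} [Group H] (s t : Bool) (x : H) :
    invIf s (invIf t x) = invIf (s ^^ t) x := by
  cases s <;> cases t <;> simp

theorem map_invIf {H H' : Type*} [Group H] [Group H'] (f : H →* H') (s : Bool) (x : H) :
    f (invIf s x) = invIf s (f x) := by
  cases s <;> simp

/-! ### Crossing systems and changes of letters -/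

/-- A system of relations `src k = lab k false * (tgt k)^{±1} * (lab k true)⁻¹` over a group `A`
between letters in `V`. It is also a graph with vertex set `V × Bool` whose edges, from
`(src k, s)` to `(tgt k, s ^^ flip k)`, are labelled by `lab k s`. -/
structure CrossingSystem (A V K : Type*) where
  /-- The letter on the left hand side. -/
  src : K → V
  /-- The letter on the right hand side. -/
  tgt : K → V
  /-- Whether the letter on the right hand side is inverted. -/
  flip : K → Bool
  /-- The coefficients. -/
  lab : K → Bool → A

namespace CrossingSystem

universe u v w

section

variable {A V K : Type*} [Group A]

/-- The relations of the system hold in `H`. -/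
def Holds (X : CrossingSystem A V K) {H : Type*} [Group H] (j : A →* H) (τ : V → H) : Prop :=
  ∀ k, τ (X.src k) = j (X.lab k false) * invIf (X.flip k) (τ (X.tgt k)) * (j (X.lab k true))⁻¹

/-- The system is developable if every labelling of its edges by elements of a group `F` is
realized in a free `F`-set on which `A` acts. -/
def Developable (X : CrossingSystem A V K) : Prop :=
  ∀ (F : Type) [Group F] (c : K → Bool → F), ∃ (S : Type w) (ρ : A →* Equiv.Perm (S × F))
    (ω : V → Bool → S × F),
    (∀ a p g, ρ a (rightTranslate p g) = rightTranslate (ρ a p) g) ∧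
    ∀ k s, ρ (X.lab k s) (ω (X.tgt k) (s ^^ X.flip k)) = rightTranslate (ω (X.src k) s) (c k s)

/-- The group `G` is generated by the letters of the system and by `A`, subject to the relations of
the system. -/
structure Universal (X : CrossingSystem A V K) {G : Type*} [Group G] (j : A →* G) (τ : V → G) :
    Prop where
  holds : X.Holds j τ
  closure_eq_top : Subgroup.closure (Set.range j ∪ Set.range τ) = ⊤
  exists_lift : ∀ (H : Type w) [Group H] (j' : A →* H) (τ' : V → H), X.Holds j' τ' →
    ∃ f : G →* H, (∀ a, f (j a) = j' a) ∧ ∀ v, f (τ v) = τ' v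

/-- The lifts in the two directions are mutually inverse on generators; `closure_eq_top` replaces
uniqueness of lifts. -/
theorem Universal.nonempty_mulEquiv {X : CrossingSystem A V K} {G : Type u} {H : Type v} [Group G]
    [Group H] {j : A →* G} {τ : V → G} {j' : A →* H} {τ' : V → H}
    (hG : Universal.{v} X j τ) (hH : Universal.{u} X j' τ') : Nonempty (G ≃* H) := by
  obtain ⟨f, hf₁, hf₂⟩ := hG.exists_lift H j' τ' hH.holds
  obtain ⟨g, hg₁, hg₂⟩ := hH.exists_lift G j τ hG.holds
  refine ⟨MonoidHom.toMulEquiv f g ?_ ?_⟩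
  · refine MonoidHom.eq_of_eqOn_dense hG.closure_eq_top ?_
    rintro _ (⟨a, rfl⟩ | ⟨v, rfl⟩) <;> simp [*]
  · refine MonoidHom.eq_of_eqOn_dense hH.closure_eq_top ?_
    rintro _ (⟨a, rfl⟩ | ⟨v, rfl⟩) <;> simp [*]

/-- The system obtained by inverting the letters `v` with `ε v = true`. -/
@[simps] def signGauge (X : CrossingSystem A V K) (ε : V → Bool) : CrossingSystem A V K where
  src := X.src
  tgt := X.tgt
  flip k := ε (X.src k) ^^ X.flip k ^^ ε (X.tgt k)
  lab k s := X.lab k (s ^^ ε (X.src k))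

/-- Inverting a letter exchanges its two sides. -/
theorem Developable.signGauge {X : CrossingSystem A V K} (hX : Developable.{w} X) (ε : V → Bool) :
    Developable.{w} (X.signGauge ε) := by
  intro F _ c
  obtain ⟨S, ρ, ω, h₁, h₂⟩ := hX F (fun k s => c k (s ^^ ε (X.src k)))
  refine ⟨S, ρ, fun v s => ω v (s ^^ ε v), h₁, fun k s => ?_⟩
  have := h₂ k (s ^^ ε (X.src k))
  simp only [Bool.xor_assoc, Bool.xor_self, Bool.xor_false] at this
  simpa [Bool.xor_assoc] using this

theorem holds_signGauge_iff (X : CrossingSystem A V K) (ε : V → Bool) {H : Type*} [Group H]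
    (j : A →* H) (τ : V → H) :
    (X.signGauge ε).Holds j τ ↔ X.Holds j (fun v => invIf (ε v) (τ v)) := by
  refine forall_congr' fun k => ?_
  simp only [signGauge_src, signGauge_tgt, signGauge_flip, signGauge_lab]
  cases ε (X.src k) <;> cases ε (X.tgt k) <;> cases X.flip k <;>
    simp [inv_eq_iff_eq_inv, mul_assoc]

theorem Universal.of_signGauge {X : CrossingSystem A V K} {ε : V → Bool} {G : Type*} [Group G]
    {j : A →* G} {τ : V → G} (h : Universal.{w} (X.signGauge ε) j τ) :
    Universal.{w} X j (fun v => invIf (ε v) (τ v)) where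
  holds := (X.holds_signGauge_iff ε j τ).1 h.holds
  closure_eq_top := by
    rw [eq_top_iff, ← h.closure_eq_top, Subgroup.closure_le]
    rintro _ (⟨a, rfl⟩ | ⟨v, rfl⟩)
    · exact Subgroup.subset_closure (Or.inl ⟨a, rfl⟩)
    · have : invIf (ε v) (τ v) ∈
          Subgroup.closure (Set.range j ∪ Set.range fun v => invIf (ε v) (τ v)) :=
        Subgroup.subset_closure (Or.inr ⟨v, rfl⟩)
      cases hv : ε v <;> simpa [hv] using this
  exists_lift H _ j' τ' h' := by
    obtain ⟨f, hf₁, hf₂⟩ := h.exists_lift H j' (fun v => invIf (ε v) (τ' v))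
      ((X.holds_signGauge_iff ε _ _).2 (by simpa [invIf_invIf] using h'))
    exact ⟨f, hf₁, fun v => by simp [map_invIf, hf₂, invIf_invIf]⟩

/-- The system for the letters `v'` with `v = p v false * v' * (p v true)⁻¹`. -/
@[simps] def gauge (X : CrossingSystem A V K) (p : V → Bool → A) : CrossingSystem A V K where
  src := X.src
  tgt := X.tgt
  flip := X.flip
  lab k s := (p (X.src k) s)⁻¹ * X.lab k s * p (X.tgt k) (s ^^ X.flip k)

/-- The side `s` of the new letter is the old one moved by `(p v s)⁻¹`. -/
theorem Developable.gauge {X : CrossingSystem A V K} (hX : Developable.{w} X) (p : V → Bool → A) :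
    Developable.{w} (X.gauge p) := by
  intro F _ c
  obtain ⟨S, ρ, ω, h₁, h₂⟩ := hX F c
  refine ⟨S, ρ, fun v s => ρ (p v s)⁻¹ (ω v s), h₁, fun k s => ?_⟩
  simp only [gauge_lab, gauge_tgt, gauge_flip, gauge_src, ← h₁, ← h₂]
  simp

theorem holds_gauge_iff (X : CrossingSystem A V K) (p : V → Bool → A) {H : Type*} [Group H]
    (j : A →* H) (τ : V → H) :
    (X.gauge p).Holds j τ ↔
      X.Holds j (fun v => j (p v false) * τ v * (j (p v true))⁻¹) := by
  refine forall_congr' fun k => ?_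
  simp only [gauge_src, gauge_tgt, gauge_flip, gauge_lab]
  rw [← mul_right_inj (j (p (X.src k) false)), ← mul_left_inj (j (p (X.src k) true))⁻¹]
  cases X.flip k <;> simp [mul_assoc]

theorem Universal.of_gauge {X : CrossingSystem A V K} {p : V → Bool → A} {G : Type*} [Group G]
    {j : A →* G} {τ : V → G} (h : Universal.{w} (X.gauge p) j τ) :
    Universal.{w} X j (fun v => j (p v false) * τ v * (j (p v true))⁻¹) where
  holds := (X.holds_gauge_iff p j τ).1 h.holds
  closure_eq_top := by
    rw [eq_top_iff, ← h.closure_eq_top, Subgroup.closure_le]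
    have hj : ∀ a, j a ∈ Subgroup.closure
        (Set.range j ∪ Set.range fun v => j (p v false) * τ v * (j (p v true))⁻¹) :=
      fun a => Subgroup.subset_closure (Or.inl ⟨a, rfl⟩)
    rintro _ (⟨a, rfl⟩ | ⟨v, rfl⟩)
    · exact hj a
    · have h₁ : j (p v false) * τ v * (j (p v true))⁻¹ ∈ Subgroup.closure
          (Set.range j ∪ Set.range fun v => j (p v false) * τ v * (j (p v true))⁻¹) :=
        Subgroup.subset_closure (Or.inr ⟨v, rfl⟩)
      have h₂ := mul_mem (mul_mem (inv_mem (hj (p v false))) h₁) (hj (p v true))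
      simpa [mul_assoc] using h₂
  exists_lift H _ j' τ' h' := by
    obtain ⟨f, hf₁, hf₂⟩ := h.exists_lift H j'
      (fun v => (j' (p v false))⁻¹ * τ' v * j' (p v true))
      ((X.holds_gauge_iff p _ _).2 (by simpa [mul_assoc] using h'))
    exact ⟨f, hf₁, fun v => by simp [hf₁, hf₂, mul_assoc]⟩

/-- The system with a single letter that is left when the relations in `T` identify all letters. -/
@[simps] def collapse (X : CrossingSystem A V K) (T : Set K) :
    CrossingSystem A Unit {k // k ∉ T} where
  src _ := ()
  tgt _ := ()
  flip k := X.flip k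
  lab k := X.lab k

/-- The relations in `T` identify all letters. -/
structure IsSpanning (X : CrossingSystem A V K) (T : Set K) (r : V) : Prop where
  flip_eq : ∀ k ∈ T, X.flip k = false
  lab_eq : ∀ k ∈ T, ∀ s, X.lab k s = 1
  induction : ∀ P : V → Prop, P r → (∀ k ∈ T, P (X.src k) ↔ P (X.tgt k)) → ∀ v, P v

/-- Labelling the relations in `T` by 1 makes the sides of all letters coincide, because the
coefficients there are trivial; the other labels stay arbitrary. -/
theorem Developable.collapse {X : CrossingSystem A V K} (hX : Developable.{w} X) {T : Set K}
    {r : V} (hT : X.IsSpanning T r) : Developable.{w} (X.collapse T) := by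
  classical
  intro F _ c
  obtain ⟨S, ρ, ω, h₁, h₂⟩ := hX F (fun k s => if h : k ∈ T then 1 else c ⟨k, h⟩ s)
  have key : ∀ v, ∀ s, ω v s = ω r s := by
    refine hT.induction _ (fun s => rfl) fun k hk => forall_congr' fun s => ?_
    have := h₂ k s
    rw [hT.lab_eq k hk, hT.flip_eq k hk] at this
    simp only [map_one, Bool.xor_false, Equiv.Perm.coe_one, id_eq, hk, dite_true,
      rightTranslate_one] at this
    rw [this]
  refine ⟨S, ρ, fun _ => ω r, h₁, fun k s => ?_⟩
  have := h₂ k s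
  rw [key, key (X.src k)] at this
  simpa [k.2] using this

theorem Universal.of_collapse {X : CrossingSystem A V K} {T : Set K} {r : V}
    (hT : X.IsSpanning T r) {G : Type*} [Group G] {j : A →* G} {τ : Unit → G}
    (h : Universal.{w} (X.collapse T) j τ) : Universal.{w} X j (fun _ => τ ()) where
  holds k := by
    by_cases hk : k ∈ T
    · simp [hT.lab_eq k hk, hT.flip_eq k hk]
    · exact h.holds ⟨k, hk⟩
  closure_eq_top := by
    rw [eq_top_iff, ← h.closure_eq_top, Subgroup.closure_le]
    rintro _ (⟨a, rfl⟩ | ⟨⟨⟩, rfl⟩)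
    · exact Subgroup.subset_closure (Or.inl ⟨a, rfl⟩)
    · exact Subgroup.subset_closure (Or.inr ⟨r, rfl⟩)
  exists_lift H _ j' τ' h' := by
    have key : ∀ v, τ' v = τ' r := by
      refine hT.induction _ rfl fun k hk => ?_
      have := h' k
      rw [hT.lab_eq k hk, hT.lab_eq k hk, hT.flip_eq k hk] at this
      simp only [map_one, one_mul, invIf_false, inv_one, mul_one] at this
      rw [this]
    obtain ⟨f, hf₁, hf₂⟩ := h.exists_lift H j' (fun _ => τ' r) (fun k => by
      have := h' k
      rw [key, key (X.tgt k)] at this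
      exact this)
    exact ⟨f, hf₁, fun v => by rw [hf₂, key v]⟩

end

end CrossingSystem

/-! ### Free groups acting on free `F`-sets -/

theorem IsFreeOfRank.of_mulEquiv {H X : Type*} [Group H] [Finite X] (e : FreeGroup X ≃* H) {r : ℤ}
    (hr : (Nat.card X : ℤ) = r) : IsFreeOfRank H r :=
  ⟨Nat.card X, hr, ⟨e.symm.trans (FreeGroup.freeGroupCongr (Finite.equivFin X))⟩⟩

/-- A permutation of `S × F` that commutes with right translations. -/
@[simps] def twistedPerm {S F : Type*} [Group F] (π : Equiv.Perm S) (κ : S → F) :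
    Equiv.Perm (S × F) where
  toFun p := (π p.1, κ p.1 * p.2)
  invFun p := (π.symm p.1, (κ (π.symm p.1))⁻¹ * p.2)
  left_inv p := by simp
  right_inv p := by simp

theorem twistedPerm_rightTranslate {S F : Type*} [Group F] (π : Equiv.Perm S) (κ : S → F)
    (p : S × F) (g : F) :
    twistedPerm π κ (rightTranslate p g) = rightTranslate (twistedPerm π κ p) g := by
  simp [rightTranslate, mul_assoc]

theorem freeGroup_lift_rightTranslate {E S F : Type*} [Group F] {x : E → Equiv.Perm (S × F)}
    (hx : ∀ e p g, x e (rightTranslate p g) = rightTranslate (x e p) g) (a : FreeGroup E) :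
    ∀ p g, FreeGroup.lift x a (rightTranslate p g) = rightTranslate (FreeGroup.lift x a p) g := by
  induction a using FreeGroup.induction_on with
  | C1 => simp
  | of e => simpa using hx e
  | inv_of e _ =>
    intro p g
    rw [map_inv, FreeGroup.lift_apply_of, Equiv.Perm.inv_eq_iff_eq, hx]
    simp
  | mul a b ha hb =>
    intro p g
    simp only [map_mul, Equiv.Perm.coe_mul, Function.comp_apply]
    rw [hb, ha]

/-- The action commutes with right translations, so the image of a word translates `p` by that word,
and translations act freely. -/
theorem injective_of_rightTranslate {J S A : Type*} [Group A]
    {ρ : A →* Equiv.Perm (S × FreeGroup J)}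
    (hρ : ∀ a p g, ρ a (rightTranslate p g) = rightTranslate (ρ a p) g) {u : FreeGroup J →* A}
    {p : S × FreeGroup J} (hp : ∀ j, ρ (u (.of j)) p = rightTranslate p (.of j)) :
    Function.Injective u := by
  have key : ∀ x, ρ (u x) p = rightTranslate p x := by
    intro x
    induction x using FreeGroup.induction_on with
    | C1 => simp
    | of j => exact hp j
    | inv_of j h =>
      rw [map_inv, map_inv, Equiv.Perm.inv_eq_iff_eq, hρ, h, ← rightTranslate_mul]
      simp
    | mul a b ha hb =>
      rw [map_mul, map_mul, Equiv.Perm.coe_mul, Function.comp_apply, hb, hρ, ha, rightTranslate_mul]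
  intro x y hxy
  exact rightTranslate_left_injective p (by rw [← key, ← key, hxy])

/-! ### The index two subgroup of a free group -/

namespace FreeGroup

variable (J : Type*)

/-- The kernel of the homomorphism from a free group onto a group of order two that is non-trivial on
exactly one basis element is free on the evident generators. This is its inclusion. -/
def doubleCover : FreeGroup (Option (J × Bool)) →* FreeGroup (Option J) :=
  lift fun
    | none => of none * of none
    | some (k, false) => of (some k)
    | some (k, true) => of none * of (some k) * (of none)⁻¹

@[simp] theorem doubleCover_none : doubleCover J (of none) = of none * of none := by
  simp [doubleCover]

@[simp] theorem doubleCover_false (k : J) :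
    doubleCover J (of (some (k, false))) = of (some k) := by
  simp [doubleCover]

@[simp] theorem doubleCover_true (k : J) :
    doubleCover J (of (some (k, true))) = of none * of (some k) * (of none)⁻¹ := by
  simp [doubleCover]

/-- This is the induced action on two cosets, indexed by `Bool`: `none` exchanges them and
contributes `σ` on its way back. The conjugation by `σ` compensates for `none⁻¹` carrying the base
point to `(true, σ⁻¹)`. -/
theorem doubleCover_injective : Function.Injective (doubleCover J) := by
  let σ : FreeGroup (Option (J × Bool)) := of none
  let x : Option J → Equiv.Perm (Bool × FreeGroup (Option (J × Bool))) := fun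
    | none => twistedPerm Equiv.boolNot fun b => if b then σ else 1
    | some k => twistedPerm (Equiv.refl _) fun b =>
        if b then σ⁻¹ * of (some (k, true)) * σ else of (some (k, false))
  have hx : ∀ e p g, x e (rightTranslate p g) = rightTranslate (x e p) g := by
    rintro (_ | k) p g <;> exact twistedPerm_rightTranslate _ _ p g
  refine injective_of_rightTranslate (ρ := lift x) (p := (false, 1))
    (freeGroup_lift_rightTranslate hx) ?_
  have hn : (x none)⁻¹ (false, 1) = (true, σ⁻¹) := by
    rw [Equiv.Perm.inv_eq_iff_eq]
    simp [x]
  rintro (_ | ⟨k, _ | _⟩)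
  · simp [x, rightTranslate, σ]
  · simp [x, rightTranslate]
  · simp only [doubleCover_true, _root_.map_mul, _root_.map_inv, lift_apply_of, Equiv.Perm.coe_mul,
      Function.comp_apply, hn]
    simp [x, rightTranslate, σ, mul_assoc]

/-- The parity `f` of the exponent of `s` shows that the two cosets differ. That there are no others
follows because the range contains `s * s` and the remaining basis, and is stable under conjugation
by `s`. -/
theorem index_range_doubleCover : (doubleCover J).range.index = 2 := by
  let s : FreeGroup (Option J) := of none
  let R := (doubleCover J).range
  have hss : s * s ∈ R := ⟨of none, by simp [s]⟩
  let f : FreeGroup (Option J) →* Equiv.Perm Bool :=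
    lift fun | none => Equiv.boolNot | some _ => 1
  have hf : ∀ x ∈ R, f x = 1 := by
    rintro _ ⟨c, rfl⟩
    have : f.comp (doubleCover J) = 1 := by
      ext1 k
      rcases k with _ | ⟨k, _ | _⟩
      · ext b
        simp [f]
      · simp [f]
      · simp [f]
    exact DFunLike.congr_fun this c
  have hconj : ∀ x ∈ R, s * x * s⁻¹ ∈ R := by
    rintro _ ⟨c, rfl⟩
    have : ∀ c, s * doubleCover J c * s⁻¹ ∈ R := by
      intro c
      induction c using FreeGroup.induction_on with
      | C1 => simp [R.one_mem]
      | of k =>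
        rcases k with _ | ⟨k, _ | _⟩
        · convert hss using 1
          simp [s, mul_assoc]
        · exact ⟨of (some (k, true)), by simp [s]⟩
        · refine ⟨of none * of (some (k, false)) * (of none)⁻¹, by simp [s, mul_assoc]⟩
      | inv_of k h =>
        convert R.inv_mem h using 1
        simp [mul_assoc]
      | mul a b ha hb =>
        convert R.mul_mem ha hb using 1
        simp [mul_assoc]
    exact this c
  have hs : ∀ b, b ∈ R ∨ b * s ∈ R := by
    intro b
    have h₁ : s⁻¹ * s⁻¹ ∈ R := by simpa using R.inv_mem hss
    have hconj' : ∀ x ∈ R, s⁻¹ * x * s ∈ R := fun x hx => by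
      have := R.mul_mem (R.mul_mem h₁ (hconj x hx)) hss
      simpa [mul_assoc] using this
    induction b using FreeGroup.induction_on with
    | C1 => exact Or.inl R.one_mem
    | of k =>
      rcases k with _ | k
      · exact Or.inr hss
      · exact Or.inl ⟨of (some (k, false)), by simp⟩
    | inv_of k _ =>
      rcases k with _ | k
      · exact Or.inr (by simp [s, R.one_mem])
      · exact Or.inl ⟨(of (some (k, false)))⁻¹, by simp⟩
    | mul a b ha hb =>
      rcases ha with ha | ha <;> rcases hb with hb | hb
      · exact Or.inl (R.mul_mem ha hb)
      · exact Or.inr (by simpa [mul_assoc] using R.mul_mem ha hb)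
      · exact Or.inr (by simpa [mul_assoc] using R.mul_mem ha (hconj' b hb))
      · have h₂ := R.mul_mem (R.mul_mem ha h₁) (hconj _ hb)
        exact Or.inl (by simpa [mul_assoc] using h₂)
  refine Subgroup.index_eq_two_iff.2 ⟨s, fun b => ?_⟩
  rcases hs b with hb | hb
  · refine Or.inr ⟨hb, fun h => ?_⟩
    have h' := hf _ (R.mul_mem (R.inv_mem hb) h)
    have := congrArg (fun π : Equiv.Perm Bool => π true) h'
    simp [f, s] at this
  · refine Or.inl ⟨hb, fun h => ?_⟩
    have h' := hf _ (R.mul_mem (R.inv_mem h) hb)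
    have := congrArg (fun π : Equiv.Perm Bool => π true) h'
    simp [f, s] at this

end FreeGroup

/-! ### HNN extensions and amalgams from systems with one letter -/

namespace CrossingSystem

universe v w

section HNN

variable {A J : Type} [Group A] (X : CrossingSystem A Unit J)

/-- The homomorphism that sends the basis to the coefficients on one side. -/
def coefficientHom (s : Bool) : FreeGroup J →* A := FreeGroup.lift fun k => X.lab k s

@[simp] theorem coefficientHom_of (s : Bool) (k : J) :
    X.coefficientHom s (FreeGroup.of k) = X.lab k s :=
  FreeGroup.lift_apply_of ..

/-- Without signs a coefficient maps a side of the letter to a translate of the same side, and the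
translation may be prescribed as the basis element. -/
theorem coefficientHom_injective (hX : Developable.{w} X) (hf : ∀ k, X.flip k = false) (s : Bool) :
    Function.Injective (X.coefficientHom s) := by
  obtain ⟨S, ρ, ω, h₁, h₂⟩ := hX (FreeGroup J) fun k _ => FreeGroup.of k
  refine injective_of_rightTranslate h₁ (p := ω () s) fun k => ?_
  have := h₂ k s
  rw [hf] at this
  simpa [coefficientHom] using this

theorem exists_hnnExtension [Finite J] (hX : Developable.{w} X) (hf : ∀ k, X.flip k = false) :
    ∃ (B₁ B₂ : Subgroup A) (φ : B₁ ≃* B₂), IsFreeOfRank B₁ (Nat.card J) ∧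
      Universal.{v} X (HNNExtension.of : A →* HNNExtension A B₁ B₂ φ)
        (fun _ => HNNExtension.t) := by
  obtain ⟨e, he⟩ : ∃ e : ∀ s, FreeGroup J ≃* (X.coefficientHom s).range,
      ∀ s x, (e s x : A) = X.coefficientHom s x :=
    ⟨fun s => MonoidHom.ofInjective (X.coefficientHom_injective hX hf s), fun s x => rfl⟩
  refine ⟨_, _, (e true).symm.trans (e false), .of_mulEquiv (e true) rfl, ?_, ?_, ?_⟩
  · intro k
    have := HNNExtension.t_mul_of (φ := (e true).symm.trans (e false)) (e true (FreeGroup.of k))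
    rw [MulEquiv.trans_apply, MulEquiv.symm_apply_apply, he, he, coefficientHom_of, coefficientHom_of] at this
    rw [hf, eq_mul_inv_iff_mul_eq]
    exact this
  · rw [eq_top_iff]
    rintro x -
    induction x using HNNExtension.induction_on with
    | of a => exact Subgroup.subset_closure (Or.inl ⟨a, rfl⟩)
    | t => exact Subgroup.subset_closure (Or.inr ⟨(), rfl⟩)
    | mul x y hx hy => exact mul_mem hx hy
    | inv x hx => exact inv_mem hx
  · intro H _ j τ h
    have key : ∀ x, τ () * j (X.coefficientHom true x) = j (X.coefficientHom false x) * τ () := by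
      intro x
      have : (j.comp (X.coefficientHom false)) =
          (MulAut.conj (τ ())).toMonoidHom.comp (j.comp (X.coefficientHom true)) := by
        ext k
        have := h k
        rw [hf, eq_mul_inv_iff_mul_eq] at this
        simpa [coefficientHom, eq_mul_inv_iff_mul_eq] using this.symm
      have h' := DFunLike.congr_fun this x
      simp only [MonoidHom.comp_apply, MulEquiv.toMonoidHom_eq_coe, MonoidHom.coe_coe,
        MulAut.conj_apply] at h'
      rw [h']
      simp
    refine ⟨HNNExtension.lift j (τ ()) ?_, HNNExtension.lift_of _ _ _,
      fun _ => HNNExtension.lift_t _ _ _⟩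
    intro a
    obtain ⟨x, rfl⟩ := (e true).surjective a
    simpa [he] using key x

end HNN

section Amalgam

variable {A J : Type} [Group A] (X : CrossingSystem A Unit J) (k₀ : J)

/-- The coefficients of the relations rewritten for the letter `s = t * lab k₀ true`, when `k₀` is
flipped: `s * s = lab k₀ false * lab k₀ true`, and `s` conjugates the second coefficient of every
other relation to the first. -/
def amalgamCoefficient : {k // k ≠ k₀} → Bool → A
  | k, false => (X.lab k₀ true)⁻¹ * X.lab k true * if X.flip k then 1 else X.lab k₀ true
  | k, true => X.lab k false * if X.flip k then (X.lab k₀ false)⁻¹ else 1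

/-- The embedding of the amalgamated subgroup into `A`. -/
def amalgamHom : FreeGroup (Option ({k // k ≠ k₀} × Bool)) →* A :=
  FreeGroup.lift fun
    | none => X.lab k₀ false * X.lab k₀ true
    | some (k, s) => X.amalgamCoefficient k₀ k s

theorem amalgamHom_injective (hX : Developable.{w} X) (hf : X.flip k₀ = true) :
    Function.Injective (X.amalgamHom k₀) := by
  classical
  let σ : FreeGroup (Option ({k // k ≠ k₀} × Bool)) := FreeGroup.of none
  -- The labels make each generator translate `ω () false` by its own basis element; for flipped
  -- relations the extra `σ` cancels the `σ⁻¹` produced by `(X.lab k₀ false)⁻¹`.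
  obtain ⟨S, ρ, ω, h₁, h₂⟩ := hX (FreeGroup (Option ({k // k ≠ k₀} × Bool))) fun k s =>
    if h : k = k₀ then (if s then 1 else σ)
    else if s then FreeGroup.of (some (⟨k, h⟩, false))
    else FreeGroup.of (some (⟨k, h⟩, true)) * if X.flip k then σ else 1
  have hl : ρ (X.lab k₀ true) (ω () false) = ω () true := by simpa [hf] using h₂ k₀ true
  have hg : ρ (X.lab k₀ false) (ω () true) = rightTranslate (ω () false) σ := by
    simpa [hf] using h₂ k₀ false
  have hl' : ∀ g, (ρ (X.lab k₀ true)).symm (rightTranslate (ω () true) g) =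
      rightTranslate (ω () false) g := fun g => by
    rw [Equiv.symm_apply_eq, h₁, hl]
  have hg' : (ρ (X.lab k₀ false)).symm (ω () false) = rightTranslate (ω () true) σ⁻¹ := by
    rw [Equiv.symm_apply_eq, h₁, hg, ← rightTranslate_mul]
    simp
  refine injective_of_rightTranslate h₁ (p := ω () false) ?_
  rintro (_ | ⟨⟨k, hk⟩, _ | _⟩)
  · simp [amalgamHom, hl, hg, σ]
  · have := h₂ k true
    cases hfk : X.flip k <;> simp [hfk, hk] at this <;>
      simp [amalgamHom, amalgamCoefficient, hfk, hl, this, hl']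
  · have := h₂ k false
    cases hfk : X.flip k <;> simp [hfk, hk] at this
    · simp [amalgamHom, amalgamCoefficient, hfk, this]
    · simp [amalgamHom, amalgamCoefficient, hfk, hg', h₁, this, ← rightTranslate_mul]

section

variable {X k₀} {G : Type*} [Group G] {jA : A →* G} {jB : FreeGroup (Option {k // k ≠ k₀}) →* G}

theorem apply_of_some_of_comp_eq (h : ∀ c, jA (X.amalgamHom k₀ c) = jB (FreeGroup.doubleCover _ c))
    (k : {k // k ≠ k₀}) : jB (FreeGroup.of (some k)) = jA (X.amalgamCoefficient k₀ k false) := by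
  simpa [amalgamHom] using (h (FreeGroup.of (some (k, false)))).symm

theorem holds_of_comp_eq (hf : X.flip k₀ = true)
    (h : ∀ c, jA (X.amalgamHom k₀ c) = jB (FreeGroup.doubleCover _ c)) :
    X.Holds jA (fun _ => jB (FreeGroup.of none) * (jA (X.lab k₀ true))⁻¹) := by
  have hs : jB (FreeGroup.of none) * jB (FreeGroup.of none) =
      jA (X.lab k₀ false) * jA (X.lab k₀ true) := by
    simpa [amalgamHom] using (h (FreeGroup.of none)).symm
  have hc : ∀ k, jB (FreeGroup.of none) * jA (X.amalgamCoefficient k₀ k false) *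
      (jB (FreeGroup.of none))⁻¹ = jA (X.amalgamCoefficient k₀ k true) := fun k => by
    rw [← apply_of_some_of_comp_eq h]
    simpa [amalgamHom] using (h (FreeGroup.of (some (k, true)))).symm
  generalize jB (FreeGroup.of none) = s at hs hc ⊢
  have h₀ : jA (X.lab k₀ false) = s * s * (jA (X.lab k₀ true))⁻¹ := by simp [hs]
  intro k
  by_cases hk : k = k₀
  · subst hk
    simp [hf, h₀, mul_assoc]
  · have := hc ⟨k, hk⟩
    cases hfk : X.flip k <;> simp only [amalgamCoefficient, hfk, map_mul, map_inv, h₀, if_true,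
      mul_one, reduceIte, Bool.false_eq_true] at this
    · simp [← this, mul_assoc]
    · rw [eq_comm, mul_inv_eq_iff_eq_mul] at this
      simp [this, mul_assoc]

theorem closure_eq_top_of_comp_eq
    (h : ∀ c, jA (X.amalgamHom k₀ c) = jB (FreeGroup.doubleCover _ c))
    (hG : Subgroup.closure (Set.range jA ∪ Set.range jB) = ⊤) :
    Subgroup.closure (Set.range jA ∪ Set.range fun _ : Unit =>
      jB (FreeGroup.of none) * (jA (X.lab k₀ true))⁻¹) = ⊤ := by
  set N := Subgroup.closure (Set.range jA ∪ Set.range fun _ : Unit =>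
      jB (FreeGroup.of none) * (jA (X.lab k₀ true))⁻¹)
  have hA : ∀ a, jA a ∈ N := fun a => Subgroup.subset_closure (Or.inl ⟨a, rfl⟩)
  have hsN : jB (FreeGroup.of none) ∈ N := by
    have : jB (FreeGroup.of none) * (jA (X.lab k₀ true))⁻¹ ∈ N :=
      Subgroup.subset_closure (Or.inr ⟨(), rfl⟩)
    simpa using mul_mem this (hA (X.lab k₀ true))
  rw [eq_top_iff, ← hG, Subgroup.closure_le]
  rintro _ (⟨a, rfl⟩ | ⟨b, rfl⟩)
  · exact hA a
  · change jB b ∈ N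
    induction b using FreeGroup.induction_on with
    | C1 => simp [N.one_mem]
    | of k =>
      rcases k with _ | k
      · exact hsN
      · rw [apply_of_some_of_comp_eq h]
        exact hA _
    | inv_of k h => simpa only [_root_.map_inv, inv_mem_iff] using h
    | mul a b ha hb => simpa only [_root_.map_mul] using mul_mem ha hb

theorem exists_hom_comp_eq (hf : X.flip k₀ = true) {τ : Unit → G} (h : X.Holds jA τ) :
    ∃ g : FreeGroup (Option {k // k ≠ k₀}) →* G,
      g (FreeGroup.of none) = τ () * jA (X.lab k₀ true) ∧
      g.comp (FreeGroup.doubleCover _) = jA.comp (X.amalgamHom k₀) := by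
  have h₀ := h k₀
  rw [hf, eq_mul_inv_iff_mul_eq, invIf_true, eq_mul_inv_iff_mul_eq, eq_comm] at h₀
  refine ⟨FreeGroup.lift fun
    | none => τ () * jA (X.lab k₀ true)
    | some k => jA (X.amalgamCoefficient k₀ k false), FreeGroup.lift_apply_of .., ?_⟩
  ext c
  rcases c with _ | ⟨k, _ | _⟩
  · simp [amalgamHom, h₀, mul_assoc]
  · simp [amalgamHom]
  · have := h k
    cases hfk : X.flip k
    · rw [hfk, invIf_false, eq_mul_inv_iff_mul_eq, ← mul_inv_eq_iff_eq_mul, eq_comm] at this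
      simp [amalgamHom, amalgamCoefficient, hfk, this, mul_assoc]
    · rw [hfk, invIf_true, eq_mul_inv_iff_mul_eq, eq_mul_inv_iff_mul_eq, eq_comm] at this
      simp [amalgamHom, amalgamCoefficient, hfk, this, h₀, mul_assoc]

end

/-- The second factor is free on `s` and one element for each relation other than `k₀`. Gluing
identifies these elements with coefficients in `A`, so only `s` is new; gluing their conjugates and
`s * s` imposes precisely the rewritten relations. -/
theorem exists_amalgamatedProduct (hf : X.flip k₀ = true) :
    ∃ (j : A →* AmalgamatedProduct (X.amalgamHom k₀) (FreeGroup.doubleCover {k // k ≠ k₀}))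
      (τ : Unit → AmalgamatedProduct (X.amalgamHom k₀) (FreeGroup.doubleCover {k // k ≠ k₀})),
      Universal.{v} X j τ := by
  let φ := amalgamMap (X.amalgamHom k₀) (FreeGroup.doubleCover {k // k ≠ k₀})
  let jA : A →* Monoid.PushoutI φ := Monoid.PushoutI.of (φ := φ) false
  let jB : FreeGroup (Option {k // k ≠ k₀}) →* Monoid.PushoutI φ :=
    Monoid.PushoutI.of (φ := φ) true
  have hAB : ∀ c, jA (X.amalgamHom k₀ c) = jB (FreeGroup.doubleCover _ c) := fun c =>
    (Monoid.PushoutI.of_apply_eq_base φ false c).trans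
      (Monoid.PushoutI.of_apply_eq_base φ true c).symm
  refine ⟨jA, _, holds_of_comp_eq hf hAB, closure_eq_top_of_comp_eq hAB ?_, ?_⟩
  · rw [eq_top_iff]
    rintro x -
    induction x using Monoid.PushoutI.induction_on with
    | of i g =>
      cases i
      · exact Subgroup.subset_closure (Or.inl ⟨g, rfl⟩)
      · exact Subgroup.subset_closure (Or.inr ⟨g, rfl⟩)
    | base c =>
      rw [← Monoid.PushoutI.of_apply_eq_base φ false c]
      exact Subgroup.subset_closure (Or.inl ⟨X.amalgamHom k₀ c, rfl⟩)
    | mul x y hx hy => exact mul_mem hx hy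
  · intro H _ j τ h
    obtain ⟨g, hg₁, hg₂⟩ := exists_hom_comp_eq hf h
    let f : ∀ i, AmalgamFactor A (FreeGroup (Option {k // k ≠ k₀})) i →* H := fun
      | false => j
      | true => g
    have hfc : ∀ i, (f i).comp (φ i) = j.comp (X.amalgamHom k₀) := by
      rintro (_ | _)
      · rfl
      · exact hg₂
    have hA : ∀ a, Monoid.PushoutI.lift f _ hfc (jA a) = j a := fun a =>
      Monoid.PushoutI.lift_of f _ hfc (i := false) a
    refine ⟨Monoid.PushoutI.lift f _ hfc, hA, fun _ => ?_⟩
    have h₁ : Monoid.PushoutI.lift f _ hfc (jB (FreeGroup.of none)) = τ () * j (X.lab k₀ true) :=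
      (Monoid.PushoutI.lift_of f _ hfc (i := true) _).trans hg₁
    rw [map_mul, map_inv, h₁, hA, mul_inv_cancel_right]

end Amalgam

end CrossingSystem

/-! ### Permutations realizing the relations of one edge -/

/-- The points lie in distinct `F`-orbits, so values on them extend equivariantly; all other orbits
are fixed pointwise. -/
theorem exists_perm_of_injective {ι S F : Type*} [Group F] {q : ι → S × F}
    (hq : Function.Injective fun i => (q i).1) (π : Equiv.Perm ι) (κ : ι → F) :
    ∃ x : Equiv.Perm (S × F), (∀ p g, x (rightTranslate p g) = rightTranslate (x p) g) ∧
      ∀ i, x (q i) = rightTranslate (q (π i)) (κ i) := by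
  let f : ι ↪ S := ⟨fun i => (q i).1, hq⟩
  refine ⟨twistedPerm (π.viaEmbedding f)
    (Function.extend f (fun i => (q (π i)).2 * κ i * (q i).2⁻¹) 1),
    twistedPerm_rightTranslate _ _, fun i => ?_⟩
  have h₁ : π.viaEmbedding f (q i).1 = (q (π i)).1 := Equiv.Perm.viaEmbedding_apply π f i
  have h₂ : Function.extend f (fun i => (q (π i)).2 * κ i * (q i).2⁻¹) 1 (q i).1 = _ :=
    f.injective.extend_apply _ _ i
  ext
  · simp [h₁, rightTranslate]
  · simp [h₂, rightTranslate]

theorem rightTranslate_pow {S F : Type*} [Mul F] {x : Equiv.Perm (S × F)}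
    (hx : ∀ p g, x (rightTranslate p g) = rightTranslate (x p) g) (k : ℕ) (p : S × F) (g : F) :
    (x ^ k) (rightTranslate p g) = rightTranslate ((x ^ k) p) g := by
  induction k with
  | zero => simp
  | succ k ih => rw [pow_succ', Equiv.Perm.mul_apply, ih, hx, Equiv.Perm.mul_apply]

/-- A permutation that moves the points of disjoint sequences of length `n + 1` cyclically, up to a
translation when it returns to the initial point. -/
theorem exists_perm_cycles {B S F : Type*} [Group F] (n : ℕ) {q : B → ℕ → S × F}
    (hq : ∀ b b' i i', i ≤ n → i' ≤ n → (q b i).1 = (q b' i').1 → b = b' ∧ i = i') (κ : B → F) :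
    ∃ x : Equiv.Perm (S × F), (∀ p g, x (rightTranslate p g) = rightTranslate (x p) g) ∧
      (∀ b i k, i + k ≤ n → (x ^ k) (q b i) = q b (i + k)) ∧
      ∀ b i k, i + k = n + 1 → k ≠ 0 → (x ^ k) (q b i) = rightTranslate (q b 0) (κ b) := by
  obtain ⟨x, hx, h⟩ := exists_perm_of_injective (ι := B × Fin (n + 1))
    (q := fun p => q p.1 p.2) (fun p p' e => by
      obtain ⟨h₁, h₂⟩ := hq _ _ _ _ (Nat.lt_succ_iff.1 p.2.2) (Nat.lt_succ_iff.1 p'.2.2) e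
      exact Prod.ext h₁ (Fin.ext h₂))
    (Equiv.prodCongr (Equiv.refl B) (finRotate (n + 1)))
    (fun p => if (p.2 : ℕ) = n then κ p.1 else 1)
  have h₁ : ∀ b i k, i + k ≤ n → (x ^ k) (q b i) = q b (i + k) := by
    intro b i k
    induction k with
    | zero => simp
    | succ k ih =>
      intro hk
      rw [pow_succ', Equiv.Perm.mul_apply, ih (by omega)]
      have := h (b, ⟨i + k, by omega⟩)
      have hlt : i + k < n := by omega
      simpa [finRotate_of_lt hlt, hlt.ne, ← add_assoc] using this
  refine ⟨x, hx, h₁, ?_⟩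
  intro b i k hk hk0
  obtain ⟨k, rfl⟩ := Nat.exists_eq_succ_of_ne_zero hk0
  rw [pow_succ', Equiv.Perm.mul_apply, h₁ b i k (by omega), show i + k = n by omega]
  have := h (b, ⟨n, by omega⟩)
  simp only [Equiv.prodCongr_apply, Prod.map_apply, Equiv.refl_apply, finRotate_last',
    if_true] at this
  exact this

/-- The inclusion of `C × F` into `(C ⊕ D) × F`. -/
def inlLeft {C D F : Type*} (p : C × F) : (C ⊕ D) × F := (Sum.inl p.1, p.2)

theorem inlLeft_rightTranslate {C D F : Type*} [Mul F] (p : C × F) (g : F) :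
    inlLeft (D := D) (rightTranslate p g) = rightTranslate (inlLeft p) g := rfl

theorem eq_rightTranslate_of_rightTranslate_eq {S F : Type*} [Group F] {p q : S × F} {g h : F}
    (e : rightTranslate p g = rightTranslate q (h * g)) : p = rightTranslate q h := by
  simpa [rightTranslate, Prod.ext_iff, ← mul_assoc] using e

/-- The action of the generator `ab` attached to an edge with label `M`. -/
theorem exists_perm_of_label {C F : Type*} [Group F] {M : ℕ} (hM : 2 ≤ M)
    {ai at' bi bt : C × F} (c₁ c₂ c₃ c₄ : F) (hbi : bi = rightTranslate at' c₂)
    (h₁ : at'.1 ≠ bt.1) (h₂ : at'.1 ≠ ai.1) (h₃ : M = 2 → ai = rightTranslate bt c₄)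
    (h₄ : M ≠ 2 → ai.1 ≠ bt.1) :
    ∃ x : Equiv.Perm ((C ⊕ Bool × ℕ) × F),
      (∀ p g, x (rightTranslate p g) = rightTranslate (x p) g) ∧
      x (inlLeft bt) = rightTranslate (inlLeft ai) c₁ ∧
      (x ^ (M / 2)) (inlLeft (if Even M then at' else ai)) = rightTranslate (inlLeft bi) c₃ ∧
      (x ^ ((M - 1) / 2)) (inlLeft (if Even M then ai else at')) =
        rightTranslate (inlLeft bt) c₄ := by
  subst hbi
  obtain ⟨m, rfl | rfl⟩ := Nat.even_or_odd' M
  · have hE : Even (2 * m) := even_two_mul m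
    simp only [hE, if_true]
    rcases eq_or_ne m 1 with rfl | hm
    · have h := h₃ rfl
      subst h
      -- For label 2, `ai` lies in the orbit of `bt`, and `x` preserves the orbits of `bt` and
      -- `at'`.
      obtain ⟨x, hx, h⟩ := exists_perm_of_injective (ι := Bool)
        (q := fun b => inlLeft (D := Bool × ℕ) (if b then at' else bt))
        (fun b b' e => by cases b <;> cases b' <;> simp_all [inlLeft, eq_comm]) (Equiv.refl _)
        (fun b => if b then c₂ * c₃ else c₄ * c₁)
      refine ⟨x, hx, ?_, ?_, ?_⟩
      · simpa [inlLeft_rightTranslate, ← rightTranslate_mul] using h false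
      · simpa [inlLeft_rightTranslate, ← rightTranslate_mul] using h true
      · simp [inlLeft_rightTranslate]
    · have hm2 : 2 ≤ m := by omega
      have h₅ := h₄ (by omega)
      obtain ⟨n, rfl⟩ : ∃ n, m = n + 1 := ⟨m - 1, by omega⟩
      -- Two cycles of length `m = n + 1`, padded by fresh points: one through `at'`, the other
      -- starting with `bt`, `ai`.
      obtain ⟨x, hx, hy, hz⟩ := exists_perm_cycles (B := Bool) n
        (q := fun b i => if b then (if i = 0 then inlLeft at' else (Sum.inr (b, i), 1))
          else (if i = 0 then inlLeft bt else if i = 1 then inlLeft (rightTranslate ai c₁)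
            else (Sum.inr (b, i), 1)))
        (fun b b' i i' _ _ e => by
          cases b <;> cases b' <;> simp only [if_true, Bool.false_eq_true, if_false] at e <;>
            split_ifs at e <;> simp_all [inlLeft, rightTranslate, eq_comm])
        (fun b => if b then c₂ * c₃ else c₄ * c₁)
      refine ⟨x, hx, ?_, ?_, ?_⟩
      · simpa [inlLeft_rightTranslate] using hy false 0 1 (by omega)
      · have := hz true 0 (n + 1) (by omega) (by omega)
        rw [show 2 * (n + 1) / 2 = n + 1 by omega]
        simpa [inlLeft_rightTranslate, ← rightTranslate_mul] using this
      · have := hz false 1 n (by omega) (by omega)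
        rw [show (2 * (n + 1) - 1) / 2 = n by omega]
        simp only [Bool.false_eq_true, if_false, one_ne_zero, if_true, inlLeft_rightTranslate,
          rightTranslate_pow hx] at this
        exact eq_rightTranslate_of_rightTranslate_eq this
  · have hE : ¬ Even (2 * m + 1) := by simp
    simp only [hE, if_false]
    have hm : 1 ≤ m := by omega
    have h₅ := h₄ (by omega)
    -- One cycle of length `2 * m + 1`: from `at'` in `m` steps to `bt`, in one step to `ai`, in `m`
    -- steps back to `at'`. The accumulated translations are built into the points.
    obtain ⟨x, hx, hy, hz⟩ := exists_perm_cycles (B := Unit) (2 * m)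
      (q := fun _ i => if i = 0 then inlLeft at' else if i = m then inlLeft (rightTranslate bt c₄)
        else if i = m + 1 then inlLeft (rightTranslate ai (c₁ * c₄))
          else (Sum.inr (true, i), 1))
      (fun b b' i i' _ _ e => by
          split_ifs at e <;> simp_all [inlLeft, rightTranslate, eq_comm])
      (fun _ => c₂ * (c₃ * (c₁ * c₄)))
    have e₁ := hy () 0 m (by omega)
    have e₂ := hy () m 1 (by omega)
    have e₃ := hz () (m + 1) m (by omega) (by omega)
    have hm0 : m ≠ 0 := by omega
    simp only [zero_add, if_true, hm0, if_false, pow_one, Nat.add_eq_zero_iff, one_ne_zero,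
      and_false, inlLeft_rightTranslate, hx, rightTranslate_pow hx, Nat.add_eq_left] at e₁ e₂ e₃
    rw [show (2 * m + 1) / 2 = m by omega, show (2 * m + 1 - 1) / 2 = m by omega]
    refine ⟨x, hx, eq_rightTranslate_of_rightTranslate_eq e₂, ?_, e₁⟩
    rw [inlLeft_rightTranslate, ← rightTranslate_mul]
    refine eq_rightTranslate_of_rightTranslate_eq (g := c₁ * c₄) ?_
    simpa [mul_assoc] using e₃

/-! ### Potentials on forests -/

namespace SimpleGraph

variable {V : Type*} {G : SimpleGraph V}

/-- The product of the values of `κ` along a walk. -/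
def Walk.prodAlong {F : Type*} [Group F] (κ : V → V → F) : ∀ {u v : V}, G.Walk u v → F
  | _, _, .nil => 1
  | _, _, .cons (u := u) (v := v) _ p => κ u v * p.prodAlong κ

theorem Walk.prodAlong_concat {F : Type*} [Group F] (κ : V → V → F) {u v w : V} (p : G.Walk u v)
    (h : G.Adj v w) : (p.concat h).prodAlong κ = p.prodAlong κ * κ v w := by
  induction p with
  | nil => simp [Walk.prodAlong, Walk.concat_nil]
  | cons h' p ih => simp [Walk.prodAlong, Walk.concat_cons, ih, mul_assoc]

/-- The potential is the product along the path from a root of the component; crossing an edge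
lengthens or shortens that path by this edge. -/
theorem IsAcyclic.exists_potential (hG : G.IsAcyclic) {F : Type*} [Group F] {κ : V → V → F}
    (hκ : ∀ u v, G.Adj u v → κ v u = (κ u v)⁻¹) :
    ∃ h : V → F, ∀ u v, G.Adj u v → h v = h u * κ u v := by
  let r (v : V) : V := (G.connectedComponentMk v).out
  have hr (v : V) : ∃ p : G.Walk (r v) v, p.IsPath := by
    have : G.Reachable (r v) v := ConnectedComponent.exact (Quot.out_eq _)
    exact this.exists_isPath
  choose p hp using hr
  refine ⟨fun v => (p v).prodAlong κ, fun u v huv => ?_⟩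
  have key : ∀ r₁ r₂, r₁ = r₂ → ∀ (p : G.Walk r₁ u) (q : G.Walk r₂ v), p.IsPath → q.IsPath →
      q.prodAlong κ = p.prodAlong κ * κ u v := by
    rintro r₁ _ rfl p q hp hq
    by_cases hu : u ∈ q.support
    · rw [hG.path_concat hp hq huv hu, Walk.prodAlong_concat]
    · have hv := hG.mem_support_of_ne_mem_support_of_adj_of_isPath hp hq huv hu
      rw [hG.path_concat hq hp huv.symm hv, Walk.prodAlong_concat, hκ u v huv]
      simp
  refine key _ _ ?_ _ _ (hp u) (hp v)
  simp only [r]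
  rw [ConnectedComponent.sound huv.reachable]

end SimpleGraph

/-! ### The graph of sides of an admissible partial orientation -/

namespace PartialOrientation

variable {V : Type*} {Γ : SimpleGraph V} (ι : PartialOrientation Γ)

/-- The edge from `u` to `v` exists and may be oriented from `u` to `v`. -/
def Compatible (u v : V) : Prop :=
  ∃ h : Γ.Adj u v, ∀ x, ι.origin ⟨s(u, v), h⟩ = some x → x = u

/-- The graph of sides of vertices whose paths are the lifts of misdirected paths. -/
def sideGraph : SimpleGraph (V × Bool) where
  Adj p q := p.2 = (!q.2) ∧ if p.2 then ι.Compatible p.1 q.1 else ι.Compatible q.1 p.1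
  symm := ⟨by
    rintro ⟨u, s⟩ ⟨v, t⟩ ⟨h₁, h₂⟩
    cases s <;> cases t <;> simp_all⟩
  loopless := ⟨by
    rintro ⟨u, s⟩ ⟨h, -⟩
    simp at h⟩

variable {ι}

theorem sideGraph_adj_fst {p q : V × Bool} (h : ι.sideGraph.Adj p q) : Γ.Adj p.1 q.1 := by
  obtain ⟨h₁, h₂⟩ := h
  split_ifs at h₂
  · exact h₂.1
  · exact h₂.1.symm

theorem eq_origin_of_sideGraph_adj {p q : V × Bool} (h : ι.sideGraph.Adj p q) (hΓ : Γ.Adj p.1 q.1)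
    {a : V} (ha : ι.origin ⟨s(p.1, q.1), hΓ⟩ = some a) : a = if p.2 then p.1 else q.1 := by
  obtain ⟨h₁, h₂⟩ := h
  split_ifs at h₂ ⊢ with hp
  · exact h₂.2 _ ha
  · refine h₂.2 _ ?_
    rw [← ha]
    congr 2
    exact Sym2.eq_swap

theorem exists_walk_fst {p q : V × Bool} (l : ι.sideGraph.Walk p q) :
    ∃ w : Γ.Walk p.1 q.1, w.length = l.length ∧ ∀ i, w.getVert i = (l.getVert i).1 :=
  let f : ι.sideGraph →g Γ := ⟨Prod.fst, sideGraph_adj_fst⟩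
  ⟨l.map f, SimpleGraph.Walk.length_map f l, fun i => SimpleGraph.Walk.getVert_map f l i⟩

/-- A closed walk all but the last of whose edges lift to the graph of sides is not an immersed
cycle. -/
theorem not_isImmersedCycle_of_getVert {M : Γ.edgeSet → ℕ} (hι : ι.IsAdmissible M) {u : V}
    (w : Γ.Walk u u) (hw : 3 ≤ w.length) {p q : V × Bool} (l : ι.sideGraph.Walk p q)
    (hl : w.length ≤ l.length + 1) (h : ∀ i, i + 1 ≤ w.length → w.getVert i = (l.getVert i).1) :
    ¬ IsImmersedCycle w := by
  intro hc
  refine hι.2 u w ⟨hc, ?_⟩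
  have hlen : w.dropLast.length = w.length - 1 := by
    simp [SimpleGraph.Walk.dropLast, SimpleGraph.Walk.take_length]
  have hget : ∀ i, i ≤ w.length - 1 → w.dropLast.getVert i = w.getVert i := fun i hi => by
    rw [SimpleGraph.Walk.dropLast, SimpleGraph.Walk.take_getVert, min_eq_right hi]
  -- An edge points forward exactly when it leaves a `true` side; sides alternate along `l`, hence
  -- so do the directions.
  refine ⟨by omega, ?_, fun i => (l.getVert i).2, ?_, ?_⟩
  · intro i hi
    rw [hget _ (by omega), hget _ (by omega)]
    exact hc.2.1 i (by omega)
  · intro i hi a ha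
    have h₁ : w.dropLast.getVert i = (l.getVert i).1 := by rw [hget _ (by omega), h _ (by omega)]
    have h₂ : w.dropLast.getVert (i + 1) = (l.getVert (i + 1)).1 := by
      rw [hget _ (by omega), h _ (by omega)]
    simp only [h₁, h₂] at ha ⊢
    exact eq_origin_of_sideGraph_adj (l.adj_getVert_succ (by omega)) _ ha
  · intro i j hij hj hd
    by_contra hlt
    have h₁ := hd i (i + 1) (by omega) (by omega) (by omega) (by omega)
    have h₂ := (l.adj_getVert_succ (i := i) (by omega)).1
    simp [h₁] at h₂

/-- Two steps restore the side, so backtracking in the projection would repeat a vertex of the path.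
-/
theorem fst_getVert_ne_of_isPath {p q : V × Bool} {l : ι.sideGraph.Walk p q} (hl : l.IsPath) {i : ℕ}
    (hi : i + 2 ≤ l.length) : (l.getVert i).1 ≠ (l.getVert (i + 2)).1 := by
  intro e
  have h₁ := (l.adj_getVert_succ (i := i) (by omega)).1
  rw [(l.adj_getVert_succ (i := i + 1) (by omega)).1, Bool.not_not] at h₁
  have := hl.getVert_injOn (by rw [Set.mem_ofPred_eq]; omega) (by rw [Set.mem_ofPred_eq]; omega)
    (Prod.ext e h₁ : l.getVert i = l.getVert (i + 2))
  omega

/-- The projection is closed. If it does not backtrack at its base point, it is an almost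
misdirected cycle. If it does, removing both end edges gives a shorter path of the same kind, whose
ends coincide by induction, which is impossible in a path. -/
theorem eq_of_isPath_of_fst_eq {M : Γ.edgeSet → ℕ} (hι : ι.IsAdmissible M) {p q : V × Bool}
    (l : ι.sideGraph.Walk p q) (hl : l.IsPath) (hpq : p.1 = q.1) : p = q := by
  generalize hn : l.length = n
  induction n using Nat.strong_induction_on generalizing p q with
  | _ n ih =>
    by_contra hne
    have hinj : ∀ i j, i ≤ n → j ≤ n → l.getVert i = l.getVert j → i = j := fun i j hi hj e =>
      hl.getVert_injOn (by rw [Set.mem_ofPred_eq]; omega) (by rw [Set.mem_ofPred_eq]; omega) e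
    have h0 : l.getVert 0 = p := l.getVert_zero
    have h1 : l.getVert n = q := hn ▸ l.getVert_length
    have hn0 : n ≠ 0 := by
      rintro rfl
      exact hne (h0 ▸ h1)
    have hn1 : n ≠ 1 := by
      rintro rfl
      have := sideGraph_adj_fst (l.adj_getVert_succ (i := 0) (by omega))
      rw [zero_add, h0, h1] at this
      exact this.ne hpq
    have hn2 : n ≠ 2 := by
      rintro rfl
      have := fst_getVert_ne_of_isPath hl (i := 0) hn.ge
      rw [zero_add, h0, h1] at this
      exact this hpq
    by_cases hb : (l.getVert (n - 1)).1 = (l.getVert 1).1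
    · have hd : (l.drop 1).getVert (n - 2) = l.getVert (n - 1) := by
        rw [SimpleGraph.Walk.drop_getVert]
        congr 1
        omega
      have := ih (n - 2) (by omega) ((l.drop 1).take (n - 2)) ((hl.drop 1).take _)
        (by rw [hd, hb]) (by
          rw [SimpleGraph.Walk.take_length, SimpleGraph.Walk.drop_length, hn]
          omega)
      rw [hd] at this
      have := hinj _ _ (by omega) (by omega) this
      omega
    · obtain ⟨w, hw, hg⟩ := exists_walk_fst l
      obtain ⟨u, s⟩ := p
      obtain ⟨v, t⟩ := q
      obtain rfl : u = v := hpq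
      refine not_isImmersedCycle_of_getVert hι w (by omega) l (by omega)
        (fun i _ => hg i) ⟨by omega, fun i hi => ?_, ?_⟩
      · rw [hg, hg]
        exact fst_getVert_ne_of_isPath hl (by omega)
      · rw [SimpleGraph.Walk.penultimate, SimpleGraph.Walk.snd, hw, hn, hg, hg]
        exact hb

/-- Otherwise the edge joining the ends closes the projection to an almost misdirected cycle:
backtracking at this edge would make a proper subpath join two vertices over the same letter,
against `eq_of_isPath_of_fst_eq`. -/
theorem length_le_one_of_isPath {M : Γ.edgeSet → ℕ} (hι : ι.IsAdmissible M) {p q : V × Bool}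
    (l : ι.sideGraph.Walk p q) (hl : l.IsPath) (hpq : Γ.Adj p.1 q.1) : l.length ≤ 1 := by
  by_contra hlt
  generalize hn : l.length = n at hlt
  have hinj : ∀ i j, i ≤ n → j ≤ n → l.getVert i = l.getVert j → i = j := fun i j hi hj e =>
    hl.getVert_injOn (by rw [Set.mem_ofPred_eq]; omega) (by rw [Set.mem_ofPred_eq]; omega) e
  have h0 : l.getVert 0 = p := l.getVert_zero
  have h1 : l.getVert n = q := hn ▸ l.getVert_length
  have hp : (l.getVert (n - 1)).1 ≠ p.1 := fun e => by
    have := eq_of_isPath_of_fst_eq hι (l.take (n - 1)) (hl.take _) e.symm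
    have := hinj 0 (n - 1) (by omega) (by omega) (h0.trans this)
    omega
  have hq : (l.getVert 1).1 ≠ q.1 := fun e => by
    have := eq_of_isPath_of_fst_eq hι (l.drop 1) (hl.drop _) e
    have := hinj 1 n (by omega) (by omega) (this.trans h1.symm)
    omega
  obtain ⟨w₀, hw₀, hg₀⟩ := exists_walk_fst l
  let w : Γ.Walk p.1 p.1 := w₀.concat hpq.symm
  have hw : w.length = n + 1 := by
    simp [w, hw₀, hn]
  have hg : ∀ i, i ≤ n → w.getVert i = (l.getVert i).1 := fun i hi => by
    simp only [w, SimpleGraph.Walk.concat_eq_append]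
    rw [SimpleGraph.Walk.getVert_append', if_pos (by omega), hg₀]
  have hlast : w.getVert (n + 1) = p.1 := hw ▸ w.getVert_length
  refine not_isImmersedCycle_of_getVert hι w (by omega) l (by omega) (fun i hi => hg i (by omega))
    ⟨by omega, fun i hi => ?_, ?_⟩
  · rcases (show i + 2 ≤ n ∨ i = n - 1 by omega) with hi' | rfl
    · rw [hg _ (by omega), hg _ (by omega)]
      exact fst_getVert_ne_of_isPath hl (by omega)
    · rw [hg _ (by omega), show n - 1 + 2 = n + 1 by omega, hlast]
      exact hp
  · rw [SimpleGraph.Walk.penultimate, SimpleGraph.Walk.snd, hw, Nat.add_sub_cancel, hg n le_rfl,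
      hg 1 (by omega), h1]
    exact hq.symm

theorem sideGraph_isAcyclic {M : Γ.edgeSet → ℕ} (hι : ι.IsAdmissible M) :
    ι.sideGraph.IsAcyclic := by
  intro p c hc
  obtain ⟨h₁, h₂⟩ := SimpleGraph.Walk.isCycle_iff_isPath_tail_and_le_length.1 hc
  have h₃ := c.length_tail_add_one hc.not_nil
  have := length_le_one_of_isPath hι c.tail h₁ (sideGraph_adj_fst (c.adj_snd hc.not_nil)).symm
  omega

theorem sideGraph_adj_of_reachable {M : Γ.edgeSet → ℕ} (hι : ι.IsAdmissible M) {p q : V × Bool}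
    (h : ι.sideGraph.Reachable p q) (hpq : Γ.Adj p.1 q.1) : ι.sideGraph.Adj p q := by
  obtain ⟨l, hl⟩ := h.exists_isPath
  have h₁ := length_le_one_of_isPath hι l hl hpq
  rcases (show l.length = 0 ∨ l.length = 1 by omega) with h₂ | h₂
  · obtain rfl := SimpleGraph.Walk.eq_of_length_eq_zero h₂
    exact (hpq.ne rfl).elim
  · exact SimpleGraph.Walk.adj_of_length_eq_one h₂

theorem eq_of_reachable_of_fst_eq {M : Γ.edgeSet → ℕ} (hι : ι.IsAdmissible M) {p q : V × Bool}
    (h : ι.sideGraph.Reachable p q) (hpq : p.1 = q.1) : p = q := by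
  obtain ⟨l, hl⟩ := h.exists_isPath
  exact eq_of_isPath_of_fst_eq hι l hl hpq

end PartialOrientation

/-! ### The Artin relations as a crossing system -/

theorem alternatingProd_two_mul {H : Type*} [Monoid H] (x y : H) (m : ℕ) :
    alternatingProd x y (2 * m) = (x * y) ^ m := by
  induction m with
  | zero => simp [alternatingProd]
  | succ m ih => simp [mul_add, alternatingProd, ih, pow_succ', mul_assoc]

theorem alternatingProd_two_mul_add_one {H : Type*} [Monoid H] (x y : H) (m : ℕ) :
    alternatingProd x y (2 * m + 1) = (x * y) ^ m * x := by
  rw [alternatingProd, alternatingProd_two_mul, mul_pow_mul]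

theorem map_alternatingProd {H H' : Type*} [Monoid H] [Monoid H'] (f : H →* H') (x y : H) (n : ℕ) :
    f (alternatingProd x y n) = alternatingProd (f x) (f y) n := by
  induction n generalizing x y with
  | zero => simp [alternatingProd]
  | succ n ih => simp [alternatingProd, ih]

/-- Since `y * (x * y) ^ m = (y * x) ^ m * y`, the relation can be solved for the first `y` on its
right hand side, leaving powers of `x * y` and one `x` or `x⁻¹`. -/
theorem alternatingProd_eq_iff {H : Type*} [Group H] (x y : H) {n : ℕ} (hn : n ≠ 0) :
    alternatingProd x y n = alternatingProd y x n ↔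
      y = (x * y) ^ (n / 2) * invIf (decide (Even n)) x * ((x * y) ^ ((n - 1) / 2))⁻¹ := by
  obtain ⟨m, rfl | rfl⟩ := Nat.even_or_odd' n
  · obtain ⟨m, rfl⟩ : ∃ k, m = k + 1 := ⟨m - 1, by omega⟩
    rw [alternatingProd_two_mul, alternatingProd_two_mul, show 2 * (m + 1) / 2 = m + 1 by omega,
      show (2 * (m + 1) - 1) / 2 = m by omega, eq_mul_inv_iff_mul_eq]
    simp only [even_two_mul, decide_true, invIf_true]
    rw [eq_mul_inv_iff_mul_eq, pow_succ' (y * x), eq_comm, mul_assoc y x, ← mul_pow_mul]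
    simp [mul_assoc]
  · rw [alternatingProd_two_mul_add_one, alternatingProd_two_mul_add_one,
      show (2 * m + 1) / 2 = m by omega, show (2 * m + 1 - 1) / 2 = m by omega,
      eq_mul_inv_iff_mul_eq, mul_pow_mul y x]
    simp [eq_comm]

/-- The system of relations of an Artin group over the free group on the products `ab` for the edges
`{a, b}`. -/
def artinSystem {V E : Type*} (a b : E → V) (M : E → ℕ) :
    CrossingSystem (FreeGroup E) V (E × Bool) where
  src k := if k.2 then b k.1 else a k.1
  tgt k := if k.2 then a k.1 else b k.1
  flip k := if k.2 then decide (Even (M k.1)) else true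
  lab k s := if k.2 then FreeGroup.of k.1 ^ (if s then (M k.1 - 1) / 2 else M k.1 / 2)
    else if s then 1 else FreeGroup.of k.1

theorem holds_artinSystem_iff {V E : Type*} (a b : E → V) {M : E → ℕ} (hM : ∀ e, M e ≠ 0)
    {H : Type*} [Group H] (j : FreeGroup E →* H) (τ : V → H) :
    (artinSystem a b M).Holds j τ ↔ ∀ e, j (FreeGroup.of e) = τ (a e) * τ (b e) ∧
      alternatingProd (τ (a e)) (τ (b e)) (M e) = alternatingProd (τ (b e)) (τ (a e)) (M e) := by
  have hy : ∀ e, (τ (a e) = j (FreeGroup.of e) * (τ (b e))⁻¹ * (j 1)⁻¹ ↔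
      j (FreeGroup.of e) = τ (a e) * τ (b e)) := fun e => by
    rw [map_one, inv_one, mul_one, eq_mul_inv_iff_mul_eq, eq_comm]
  constructor
  · intro h e
    have h₁ := (hy e).1 (by simpa [artinSystem] using h (e, false))
    refine ⟨h₁, (alternatingProd_eq_iff _ _ (hM e)).2 ?_⟩
    have h₂ := h (e, true)
    simpa [artinSystem, h₁] using h₂
  · rintro h ⟨e, _ | _⟩
    · simpa [artinSystem] using (hy e).2 (h e).1
    · have h₂ := (alternatingProd_eq_iff _ _ (hM e)).1 (h e).2
      simpa [artinSystem, (h e).1] using h₂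

section

universe u

variable {V : Type u} {Γ : SimpleGraph V} {M : Γ.edgeSet → ℕ} {E : Type} {η : E ≃ Γ.edgeSet}
  {a b : E → V} (hab : ∀ e, (η e : Sym2 V) = s(a e, b e))

include hab

theorem adj_of_edge_eq (e : E) : Γ.Adj (a e) (b e) := by
  have := (η e).2
  rwa [hab, SimpleGraph.mem_edgeSet] at this

theorem symm_edge_eq {u v : V} {e : E} (h : Γ.Adj u v) (he : s(u, v) = s(a e, b e)) :
    η.symm ⟨s(u, v), h⟩ = e := by
  rw [Equiv.symm_apply_eq]
  exact Subtype.ext (he.trans (hab e).symm)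

theorem edge_eq_mk (e : E) (h : Γ.Adj (a e) (b e)) : η e = ⟨s(a e, b e), h⟩ := Subtype.ext (hab e)

theorem edge_eq_mk_symm (e : E) (h : Γ.Adj (b e) (a e)) : η e = ⟨s(b e, a e), h⟩ :=
  Subtype.ext ((hab e).trans Sym2.eq_swap)

theorem universal_artinGroup (hM : ∀ e, M e ≠ 0) :
    ∃ j : FreeGroup E →* ArtinGroup Γ M,
      CrossingSystem.Universal (artinSystem a b fun e => M (η e)) j PresentedGroup.of := by
  let τ : V → ArtinGroup Γ M := PresentedGroup.of
  refine ⟨FreeGroup.lift fun e => τ (a e) * τ (b e), ?_, ?_, ?_⟩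
  · refine (holds_artinSystem_iff a b (fun e => hM _) _ _).2 fun e =>
      ⟨FreeGroup.lift_apply_of .., ?_⟩
    have hadj := adj_of_edge_eq hab e
    have := PresentedGroup.one_of_mem (rels := artinRelators Γ M) ⟨a e, b e, hadj, rfl⟩
    rw [map_mul, map_inv, mul_inv_eq_one, map_alternatingProd, map_alternatingProd,
      ← edge_eq_mk hab] at this
    exact this
  · rw [Subgroup.closure_union, PresentedGroup.closure_range_of, sup_top_eq]
  · intro H _ j' τ' h
    have h' := (holds_artinSystem_iff a b (fun e => hM _) _ _).1 h
    have hrel : ∀ r ∈ artinRelators Γ M, FreeGroup.lift τ' r = 1 := by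
      rintro _ ⟨u, v, huv, rfl⟩
      rw [map_mul, map_inv, mul_inv_eq_one, map_alternatingProd, map_alternatingProd,
        FreeGroup.lift_apply_of, FreeGroup.lift_apply_of]
      obtain ⟨e, he⟩ := η.surjective ⟨s(u, v), huv⟩
      have hs : s(a e, b e) = s(u, v) := by rw [← hab, he]
      rw [← he]
      rcases Sym2.eq_iff.1 hs with ⟨rfl, rfl⟩ | ⟨rfl, rfl⟩
      · exact (h' e).2
      · exact (h' e).2.symm
    refine ⟨PresentedGroup.toGroup hrel, ?_, fun v => PresentedGroup.toGroup.of hrel⟩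
    have : (PresentedGroup.toGroup hrel).comp (FreeGroup.lift fun e => τ (a e) * τ (b e)) = j' := by
      ext e
      simp [τ, PresentedGroup.toGroup.of hrel, (h' e).1]
    exact fun x => DFunLike.congr_fun this x

theorem developable_artinSystem (hM : ∀ e, 2 ≤ M e) {ι : PartialOrientation Γ}
    (hι : ι.IsAdmissible M) (ho : ∀ e x, ι.origin (η e) = some x → x = a e) :
    CrossingSystem.Developable.{u} (artinSystem a b fun e => M (η e)) := by
  classical
  intro F _ c
  -- The label of the relation that ties the `true` side of `u` to the `false` side of `v` by a
  -- trivial coefficient; that of `(e, true)` is trivial only for label 2.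
  let cc (u v : V) : F := if h : Γ.Adj u v then
    (if a (η.symm ⟨s(u, v), h⟩) = u then c (η.symm ⟨s(u, v), h⟩, false) true
      else c (η.symm ⟨s(u, v), h⟩, true) true) else 1
  let κ (p q : V × Bool) : F := if p.2 then cc p.1 q.1 else (cc q.1 p.1)⁻¹
  obtain ⟨pot, hpot⟩ := (PartialOrientation.sideGraph_isAcyclic hι).exists_potential (κ := κ) (by
    rintro ⟨u, s⟩ ⟨v, t⟩ ⟨h, -⟩
    obtain rfl : s = !t := h
    cases t <;> simp [κ])
  let ωC (p : V × Bool) : ι.sideGraph.ConnectedComponent × F :=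
    (ι.sideGraph.connectedComponentMk p, pot p)
  have hω : ∀ p q, ι.sideGraph.Adj p q → ωC q = rightTranslate (ωC p) (κ p q) := fun p q h =>
    Prod.ext (SimpleGraph.ConnectedComponent.sound h.symm.reachable) (hpot p q h)
  have hne : ∀ e, a e ≠ b e := fun e => (adj_of_edge_eq hab e).ne
  have hreach : ∀ p q, (ωC p).1 = (ωC q).1 → ι.sideGraph.Reachable p q := fun p q h =>
    SimpleGraph.ConnectedComponent.exact h
  have hbi : ∀ e, ωC (b e, false) = rightTranslate (ωC (a e, true)) (c (e, false) true) := by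
    intro e
    have hadj := adj_of_edge_eq hab e
    rw [hω (a e, true) (b e, false) ⟨rfl, hadj, fun x hx => ho e x (edge_eq_mk hab e hadj ▸ hx)⟩]
    simp [κ, cc, hadj, symm_edge_eq hab hadj rfl]
  have hai : ∀ e, M (η e) = 2 →
      ωC (a e, false) = rightTranslate (ωC (b e, true)) (c (e, true) true) := by
    intro e he
    have hadj := (adj_of_edge_eq hab e).symm
    rw [hω (b e, true) (a e, false) ⟨rfl, hadj, fun x hx => ?_⟩]
    · simp [κ, cc, hadj, symm_edge_eq hab hadj Sym2.eq_swap, hne e]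
    · rw [← edge_eq_mk_symm hab] at hx
      have := (hι.1 (η e)).1 ⟨x, hx⟩
      omega
  -- The separation conditions: connected sides over adjacent vertices are adjacent, so they have
  -- opposite types; the two sides of one vertex are never connected; and `(a e, false)`, `(b e,
  -- true)` are adjacent only if `e` may be oriented from `b e`, which fails for labels at least 3.
  choose x hx₁ hx₂ hx₃ hx₄ using fun e => exists_perm_of_label (hM (η e)) (c (e, false) false)
    (c (e, false) true) (c (e, true) false) (c (e, true) true) (hbi e)
    (fun h => by
      have := PartialOrientation.sideGraph_adj_of_reachable hι (hreach _ _ h) (adj_of_edge_eq hab e)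
      simpa using this.1)
    (fun h => by
      have := PartialOrientation.eq_of_reachable_of_fst_eq hι
        (hreach (a e, true) (a e, false) h) rfl
      simp at this)
    (hai e)
    (fun h₂ h => by
      have := PartialOrientation.sideGraph_adj_of_reachable hι
        (hreach (a e, false) (b e, true) h) (adj_of_edge_eq hab e)
      obtain ⟨-, hadj, h₃⟩ := this
      obtain ⟨y, hy⟩ := (hι.1 (η e)).2 (by have := hM (η e); omega)
      have h₄ := h₃ y (by rw [← edge_eq_mk_symm hab]; exact hy)
      exact hne e ((ho e y hy).symm.trans h₄))
  refine ⟨_, FreeGroup.lift x, fun v s => inlLeft (ωC (v, s)),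
    freeGroup_lift_rightTranslate hx₁, ?_⟩
  rintro ⟨e, _ | _⟩ (_ | _)
  · simpa [artinSystem] using hx₂ e
  · simp [artinSystem, hbi, inlLeft_rightTranslate]
  · have := hx₃ e
    by_cases hE : Even (M (η e)) <;> simpa [artinSystem, hE] using this
  · have := hx₄ e
    by_cases hE : Even (M (η e)) <;> simpa [artinSystem, hE] using this

end

/-! ### Collapsing along a spanning tree -/

namespace CrossingSystem

variable {A V K : Type*} {X : CrossingSystem A V K} {T : SimpleGraph V} {S : Set K}

/-- On each side separately, the coefficients along the tree have a potential, and dividing by it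
makes them trivial. -/
theorem exists_gauge_isSpanning [Group A] (hT : T.IsTree) (hadj : ∀ k ∈ S, T.Adj (X.src k) (X.tgt k))
    (hinj : ∀ k ∈ S, ∀ l ∈ S, s(X.src k, X.tgt k) = s(X.src l, X.tgt l) → k = l)
    (hsurj : ∀ u v, T.Adj u v → ∃ k ∈ S, s(X.src k, X.tgt k) = s(u, v))
    (hflip : ∀ k ∈ S, X.flip k = false) (r : V) :
    ∃ p : V → Bool → A, (X.gauge p).IsSpanning S r := by
  classical
  let κ (s : Bool) (u v : V) : A :=
    if h : ∃ k ∈ S, X.src k = u ∧ X.tgt k = v then X.lab h.choose s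
    else if h : ∃ k ∈ S, X.src k = v ∧ X.tgt k = u then (X.lab h.choose s)⁻¹ else 1
  have h₁ : ∀ k ∈ S, ∀ s, κ s (X.src k) (X.tgt k) = X.lab k s := by
    intro k hk s
    have h : ∃ l ∈ S, X.src l = X.src k ∧ X.tgt l = X.tgt k := ⟨k, hk, rfl, rfl⟩
    have : h.choose = k := hinj _ h.choose_spec.1 _ hk (by
      rw [h.choose_spec.2.1, h.choose_spec.2.2])
    simp only [κ, dif_pos h, this]
  have h₂ : ∀ k ∈ S, ∀ s, κ s (X.tgt k) (X.src k) = (X.lab k s)⁻¹ := by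
    intro k hk s
    have h : ∃ l ∈ S, X.src l = X.src k ∧ X.tgt l = X.tgt k := ⟨k, hk, rfl, rfl⟩
    have h' : ¬ ∃ l ∈ S, X.src l = X.tgt k ∧ X.tgt l = X.src k := by
      rintro ⟨l, hl, e₁, e₂⟩
      have : l = k := hinj _ hl _ hk (by rw [e₁, e₂, Sym2.eq_swap])
      subst this
      exact (hadj l hl).ne e₁
    have : h.choose = k := hinj _ h.choose_spec.1 _ hk (by
      rw [h.choose_spec.2.1, h.choose_spec.2.2])
    simp only [κ, dif_neg h', dif_pos h, this]
  have h₃ : ∀ s u v, T.Adj u v → κ s v u = (κ s u v)⁻¹ := by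
    intro s u v huv
    obtain ⟨k, hk, e⟩ := hsurj u v huv
    rcases Sym2.eq_iff.1 e with ⟨rfl, rfl⟩ | ⟨rfl, rfl⟩
    · rw [h₁ k hk, h₂ k hk]
    · rw [h₁ k hk, h₂ k hk, inv_inv]
  choose pot hpot using fun s => hT.isAcyclic.exists_potential (h₃ s)
  refine ⟨fun v s => (pot s v)⁻¹, hflip, fun k hk s => ?_, fun P hP h v => ?_⟩
  · simp only [gauge_lab, hflip k hk, Bool.xor_false]
    rw [hpot s _ _ (hadj k hk), h₁ k hk]
    simp
  · obtain ⟨w⟩ := hT.connected.preconnected r v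
    induction w with
    | nil => exact hP
    | cons huv _ ih =>
      refine ih ?_
      obtain ⟨k, hk, e⟩ := hsurj _ _ huv
      have hk' : P (X.src k) ↔ P (X.tgt k) := h k hk
      rcases Sym2.eq_iff.1 e with ⟨rfl, rfl⟩ | ⟨rfl, rfl⟩
      · exact hk'.1 hP
      · exact hk'.2 hP

theorem card_compl_tree [Finite V] [Finite K] (hT : T.IsTree)
    (hadj : ∀ k ∈ S, T.Adj (X.src k) (X.tgt k))
    (hinj : ∀ k ∈ S, ∀ l ∈ S, s(X.src k, X.tgt k) = s(X.src l, X.tgt l) → k = l)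
    (hsurj : ∀ u v, T.Adj u v → ∃ k ∈ S, s(X.src k, X.tgt k) = s(u, v)) :
    Nat.card {k // k ∉ S} + Nat.card V = Nat.card K + 1 := by
  classical
  have h₁ : Nat.card S = Nat.card T.edgeSet := Nat.card_congr <| Equiv.ofBijective
    (fun k : S => (⟨s(X.src k, X.tgt k), hadj k k.2⟩ : T.edgeSet))
    ⟨fun k l e => Subtype.ext (hinj _ k.2 _ l.2 (congrArg Subtype.val e)), by
      rintro ⟨e, he⟩
      induction e using Sym2.ind with
      | _ u v =>
        obtain ⟨k, hk, e⟩ := hsurj u v he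
        exact ⟨⟨k, hk⟩, Subtype.ext e⟩⟩
  have h₂ := (SimpleGraph.isTree_iff_connected_and_card.1 hT).2
  have h₃ : Nat.card S + Nat.card {k // k ∉ S} = Nat.card K := by
    rw [← Nat.card_sum]
    exact Nat.card_congr (Equiv.sumCompl (· ∈ S))
  omega

end CrossingSystem

theorem SimpleGraph.IsBipartite.exists_bool {V : Type*} {G : SimpleGraph V} (h : G.IsBipartite) :
    ∃ ε : V → Bool, ∀ u v, G.Adj u v → ε u = !ε v := by
  obtain ⟨C⟩ := h
  refine ⟨fun v => finTwoEquiv (C v), fun u v huv => Bool.eq_not.2 ?_⟩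
  exact finTwoEquiv.injective.ne (C.valid huv)

/-! ### Proof of the theorem -/

section

universe u

variable {V : Type u} [Finite V] {Γ : SimpleGraph V} {M : Γ.edgeSet → ℕ} {ι : PartialOrientation Γ}

theorem exists_universal_of_tree (hM : ∀ e, 2 ≤ M e) (hι : ι.IsAdmissible M) {T : SimpleGraph V}
    (hTΓ : T ≤ Γ) (hT : T.IsTree) {ε : V → Bool} (hε : ∀ u v, T.Adj u v → ε u = !ε v) :
    ∃ (A J : Type) (_ : Group A) (_ : Finite J) (X : CrossingSystem A Unit J),
      IsFreeOfRank A (Nat.card Γ.edgeSet) ∧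
      Nat.card J + Nat.card V = 2 * Nat.card Γ.edgeSet + 1 ∧
      CrossingSystem.Developable.{u} X ∧
      ((∀ k, X.flip k = false) ↔ (∀ u v, Γ.Adj u v → ε u = !ε v) ∧ ∀ e, Even (M e)) ∧
      ∀ (G : Type) [Group G] (j : A →* G) (τ : Unit → G), CrossingSystem.Universal.{u} X j τ →
        Nonempty (ArtinGroup Γ M ≃* G) := by
  let n := Nat.card Γ.edgeSet
  let η : Fin n ≃ Γ.edgeSet := (Finite.equivFin Γ.edgeSet).symm
  obtain ⟨a, b, hab, ho⟩ : ∃ a b : Fin n → V, (∀ e, (η e : Sym2 V) = s(a e, b e)) ∧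
      ∀ e x, ι.origin (η e) = some x → x = a e := by
    have : ∀ e, ∃ u v : V, (η e : Sym2 V) = s(u, v) ∧ ∀ x, ι.origin (η e) = some x → x = u := by
      intro e
      rcases h : ι.origin (η e) with _ | u
      · obtain ⟨⟨u, v⟩, huv⟩ := Quot.exists_rep (η e : Sym2 V)
        exact ⟨u, v, huv.symm, by simp⟩
      · obtain ⟨v, hv⟩ := ι.origin_mem _ _ h
        exact ⟨u, v, hv, by simp [eq_comm]⟩
    choose a b h₁ h₂ using this
    exact ⟨a, b, h₁, h₂⟩
  let X := artinSystem a b fun e => M (η e)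
  -- Each tree edge contributes its relation a = x b⁻¹, whose sign disappears once one colour class
  -- is inverted.
  let S : Set (Fin n × Bool) := {k | k.2 = false ∧ (η k.1 : Sym2 V) ∈ T.edgeSet}
  have hsrc : ∀ e, s(X.src (e, false), X.tgt (e, false)) = (η e : Sym2 V) := fun e => (hab e).symm
  have hadj : ∀ k ∈ S, T.Adj (X.src k) (X.tgt k) := by
    rintro ⟨e, s⟩ ⟨rfl, he⟩
    rwa [← hsrc] at he
  have hinj : ∀ k ∈ S, ∀ l ∈ S, s(X.src k, X.tgt k) = s(X.src l, X.tgt l) → k = l := by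
    rintro ⟨e, s⟩ ⟨rfl, -⟩ ⟨e', s'⟩ ⟨rfl, -⟩ h
    rw [hsrc, hsrc] at h
    rw [η.injective (Subtype.ext h)]
  have hsurj : ∀ u v, T.Adj u v → ∃ k ∈ S, s(X.src k, X.tgt k) = s(u, v) := by
    intro u v h
    have h₁ : (η (η.symm ⟨s(u, v), hTΓ h⟩) : Sym2 V) = s(u, v) := by rw [Equiv.apply_symm_apply]
    exact ⟨(η.symm ⟨s(u, v), hTΓ h⟩, false), ⟨rfl, by rw [h₁]; exact h⟩, by rw [hsrc, h₁]⟩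
  have hf₀ : ∀ e, (X.signGauge ε).flip (e, false) = (ε (a e) ^^ true ^^ ε (b e)) := fun _ => rfl
  have hf₁ : ∀ e, (X.signGauge ε).flip (e, true) =
      (ε (b e) ^^ decide (Even (M (η e))) ^^ ε (a e)) := fun _ => rfl
  have hflip : ∀ k ∈ S, (X.signGauge ε).flip k = false := by
    rintro ⟨e, s⟩ ⟨rfl, he⟩
    have : ε (a e) = !ε (b e) := hε _ _ (hadj (e, false) ⟨rfl, he⟩)
    exact (hf₀ e).trans (by simp [this])
  obtain ⟨r⟩ := hT.connected.nonempty
  obtain ⟨p, hp⟩ := CrossingSystem.exists_gauge_isSpanning (X := X.signGauge ε) hT hadj hinj hsurj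
    hflip r
  refine ⟨FreeGroup (Fin n), {k // k ∉ S}, inferInstance, inferInstance,
    ((X.signGauge ε).gauge p).collapse S, .of_mulEquiv (MulEquiv.refl _) (by simp [n]), ?_,
    (((developable_artinSystem hab hM hι ho).signGauge ε).gauge p).collapse hp, ⟨?_, ?_⟩, ?_⟩
  · rw [CrossingSystem.card_compl_tree hT hadj hinj hsurj]
    simp [n, mul_comm]
  · intro h
    have hall : ∀ k, (X.signGauge ε).flip k = false := fun k => by
      by_cases hk : k ∈ S
      · exact hflip k hk
      · exact h ⟨k, hk⟩
    have hy : ∀ e, ε (a e) = !ε (b e) := fun e => by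
      have := (hf₀ e).symm.trans (hall (e, false))
      revert this
      cases ε (a e) <;> cases ε (b e) <;> simp
    constructor
    · intro u v huv
      obtain ⟨e, he⟩ := η.surjective ⟨s(u, v), huv⟩
      have hs : s(a e, b e) = s(u, v) := by rw [← hab, he]
      rcases Sym2.eq_iff.1 hs with ⟨rfl, rfl⟩ | ⟨rfl, rfl⟩
      · exact hy e
      · simp [hy e]
    · intro e
      obtain ⟨e, rfl⟩ := η.surjective e
      have := (hf₁ e).symm.trans (hall (e, true))
      rw [hy e] at this
      by_contra hE
      cases h : ε (b e) <;> simp [h, hE] at this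
  · rintro ⟨h₁, h₂⟩ ⟨⟨e, s⟩, -⟩
    have := h₁ _ _ (adj_of_edge_eq hab e)
    cases s
    · exact (hf₀ e).trans (by simp [this])
    · exact (hf₁ e).trans (by simp [this, h₂ (η e)])
  · intro G _ j τ hG
    obtain ⟨j', hA⟩ := universal_artinGroup.{u, 0} hab fun e => (zero_lt_two.trans_le (hM e)).ne'
    exact hA.nonempty_mulEquiv (hG.of_collapse hp).of_gauge.of_signGauge

end

theorem theoremB {V : Type*} [Finite V] (Γ : SimpleGraph V) (hΓ : Γ.Connected)
    (M : Γ.edgeSet → ℕ) (hM : ∀ e, 2 ≤ M e)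
    (ι : PartialOrientation Γ) (hι : ι.IsAdmissible M) :
    ((Γ.IsBipartite ∧ ∀ e, Even (M e)) →
      ∃ (A : Type) (_ : Group A) (B₁ B₂ : Subgroup A) (φ : B₁ ≃* B₂),
        IsFreeOfRank A (Nat.card Γ.edgeSet) ∧
        IsFreeOfRank B₁ (1 - Nat.card V + 2 * Nat.card Γ.edgeSet) ∧
        Nonempty (ArtinGroup Γ M ≃* HNNExtension A B₁ B₂ φ)) ∧
    (¬ (Γ.IsBipartite ∧ ∀ e, Even (M e)) →
      ∃ (A B C : Type) (_ : Group A) (_ : Group B) (_ : Group C) (α : C →* A) (β : C →* B),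
        Function.Injective α ∧ Function.Injective β ∧
        IsFreeOfRank A (Nat.card Γ.edgeSet) ∧
        IsFreeOfRank B (1 - Nat.card V + 2 * Nat.card Γ.edgeSet) ∧
        β.range.index = 2 ∧
        IsFreeOfRank C (1 - 2 * Nat.card V + 4 * Nat.card Γ.edgeSet) ∧
        Nonempty (ArtinGroup Γ M ≃* AmalgamatedProduct α β)) := by
  classical
  obtain ⟨T, hTΓ, hT⟩ := hΓ.exists_isTree_le
  constructor
  · rintro ⟨hb, hE⟩
    obtain ⟨ε, hε⟩ := hb.exists_bool
    obtain ⟨A, J, _, _, X, hA, hJ, hX, hflip, hG⟩ :=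
      exists_universal_of_tree hM hι hTΓ hT fun u v h => hε u v (hTΓ h)
    obtain ⟨B₁, B₂, φ, hB, hU⟩ := X.exists_hnnExtension hX (hflip.2 ⟨hε, hE⟩)
    refine ⟨A, _, B₁, B₂, φ, hA, ?_, hG _ _ _ hU⟩
    convert hB using 1
    omega
  · intro hn
    -- Only the tree is coloured, since `Γ` need not be bipartite.
    obtain ⟨ε, hε⟩ := hT.isBipartite.exists_bool
    obtain ⟨A, J, _, _, X, hA, hJ, hX, hflip, hG⟩ := exists_universal_of_tree hM hι hTΓ hT hε
    -- Without a remaining sign, the colouring of the tree would be one of `Γ` and all labels would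
    -- be even.
    obtain ⟨k₀, hk₀⟩ : ∃ k, X.flip k = true := by
      by_contra! h
      obtain ⟨h₁, h₂⟩ := hflip.1 fun k => by simpa using h k
      refine hn ⟨⟨SimpleGraph.Coloring.mk (fun v => finTwoEquiv.symm (ε v)) fun {u v} huv e => ?_⟩,
        h₂⟩
      have := finTwoEquiv.symm.injective e
      simp [h₁ u v huv] at this
    obtain ⟨j, τ, hU⟩ := X.exists_amalgamatedProduct k₀ hk₀
    have hc : Nat.card (Option {k // k ≠ k₀}) = Nat.card J :=
      Nat.card_congr (Equiv.optionSubtypeNe k₀)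
    refine ⟨A, _, _, _, _, _, X.amalgamHom k₀, FreeGroup.doubleCover _,
      X.amalgamHom_injective k₀ hX hk₀, FreeGroup.doubleCover_injective _, hA,
      .of_mulEquiv (MulEquiv.refl _) ?_, FreeGroup.index_range_doubleCover _,
      .of_mulEquiv (MulEquiv.refl _) ?_, hG _ _ _ hU⟩
    · rw [hc]
      omega
    · rw [Finite.card_option] at hc ⊢
      rw [Nat.card_prod, Nat.card_eq_fintype_card (α := Bool), Fintype.card_bool]
      omega
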